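/- Let $E$ be a topological space with its Borel $\sigma$-algebra and let $m$ be a $\sigma$-finite measure on $E$ (for example, a Radon space with a $\sigma$-finite Radon measure). Let $P$ be a Markov transition kernel on $E$ with a jointly measurable density $p\ge 0$, i.e. $P(x,dy)=p(x,y)\,m(dy)$ for every $x\in E$, and let $\lambda:E\to(0,\infty)$ be measurable. Let $Y$ be the continuous-time jump process whose jump chain is the Markov chain with kernel $P$ and whose holding times are independent, with law $\mathrm{Exp}(\lambda(x))$ in state $x$. Assume that $Y$ is nonexplosive: from every starting point its jump times tend to infinity almost surely. Let $\pi:E\to(0,\infty)$ and $\mu:E\to[0,\infty)$ be probability densities with respect to $m$, with $\int\lambda\pi\,dm<\infty$. Let $C\in\mathbb R$, assume that $\int\pi(y)\lambda(y)p(y,x)\,m(dy)<\infty$ for every $x\in E$, and put $$\kappa(x)=\frac{\int \pi(y)\lambda(y)p(y,x)\,m(dy)-\lambda(x)\pi(x)}{\pi(x)}+C\,\frac{\mu(x)}{\pi(x)},\qquad x\in E.$$ Assume that $\kappa\ge0$ on $E$, that $\kappa$ is locally bounded, and that $\int(\lambda+\kappa)^2\pi\,dm<\infty$. Define the lifetime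 $\tau_\partial=\inf\{t\ge0:\int_0^t\kappa(Y_s)\,ds\ge\xi\}$ (with $\inf\varnothing=\infty$), where $\xi\sim\mathrm{Exp}(1)$ is independent of $Y$. The Restore process $X$ started at $x$ is $$X_t=\sum_{i=0}^\infty 1_{[T_i,T_{i+1})}(t)\,Y^{(i)}_{t-T_i},\qquad T_0=0,\quad T_n=\sum_{i=0}^{n-1}\tau^{(i)},$$ where $(Y^{(0)},\tau^{(0)})$ is a realisation of $(Y,\tau_\partial)$ with $Y_0=x$ and, independently of it, $(Y^{(i)},\tau^{(i)})_{i\ge1}$ are i.i.d. realisations of $(Y,\tau_\partial)$ with $Y_0\sim\mu(y)\,m(dy)$. Then $X$ is a nonexplosive jump process with invariant distribution $\pi(x)\,m(dx)$. That is: $X$ is a time-homogeneous Markov process with respect to its natural filtration; from every starting point, almost surely $T_n\to\infty$ and the path of $X$ is right-continuous and piecewise constant on $[0,\infty)$ with finitely many jumps in every bounded time interval; and if $X_0$ has law $\pi(x)\,m(dx)$, then $X_t$ has law $\pi(x)\,m(dx)$ for every $t\ge0$. -/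

import Mathlib

open MeasureTheory ProbabilityTheory

namespace Restore

noncomputable section

/-- The standard exponential distribution is a probability measure. -/
instance isProbabilityMeasure_exp_one : IsProbabilityMeasure (expMeasure 1) :=
  isProbabilityMeasure_expMeasure one_pos

/-! ### Continuous-time jump processes -/

/-- The law of the discrete-time Markov chain `(Z₀, Z₁, …)` with transition kernel `P`,
as a kernel in its starting point `Z₀ = x`. -/
def chainKernel {E : Type*} [MeasurableSpace E] (P : Kernel E E) [IsMarkovKernel P] :
    Kernel E (ℕ → E) :=
  (Kernel.traj (X := fun _ => E)
    (fun n => P.comap (fun h : (i : Finset.Iic n) → E => h ⟨n, Finset.mem_Iic.2 le_rfl⟩)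
      (measurable_pi_apply _)) 0).comap (fun x _ => x) (measurable_pi_lambda _ fun _ => measurable_id)

instance {E : Type*} [MeasurableSpace E] (P : Kernel E E) [IsMarkovKernel P] :
    IsMarkovKernel (chainKernel P) := by
  unfold chainKernel; infer_instance

/-- The randomness that drives a jump process: the jump chain `(Zₙ)` and the unit-rate
exponential clocks `(eₙ)`. -/
abbrev JumpSample (E : Type*) := (ℕ → E) × (ℕ → ℝ)

/-- Law of the driving randomness, as a kernel in the starting point: a Markov chain with
transition kernel `P`, and independent i.i.d. `Exp(1)` variables. -/
def jumpKernel {E : Type*} [MeasurableSpace E] (P : Kernel E E) [IsMarkovKernel P] :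
    Kernel E (JumpSample E) :=
  chainKernel P ×ₖ Kernel.const E (Measure.infinitePi fun _ : ℕ => expMeasure 1)

instance {E : Type*} [MeasurableSpace E] (P : Kernel E E) [IsMarkovKernel P] :
    IsMarkovKernel (jumpKernel P) := by
  unfold jumpKernel; infer_instance

/-- The time of the `n`-th jump. The holding time at `Z_k` is `e_k / rate (Z_k)`, which has
the distribution `Exp (rate (Z_k))`. -/
def jumpTime {E : Type*} (rate : E → ℝ) (ω : JumpSample E) (n : ℕ) : ℝ :=
  ∑ k ∈ Finset.range n, ω.2 k / rate (ω.1 k)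

/-- The state of the jump process at time `t`: it equals `Zₙ` for
`jumpTime n ≤ t < jumpTime (n + 1)`. -/
def jumpProcess {E : Type*} (rate : E → ℝ) (ω : JumpSample E) (t : ℝ) : E :=
  ω.1 (sInf {n : ℕ | t < jumpTime rate ω (n + 1)})

/-- The jump process with jump chain `P` and holding rates `rate` is nonexplosive: from every
starting point, the jump times almost surely tend to infinity. -/
def Nonexplosive {E : Type*} [MeasurableSpace E] (P : Kernel E E) [IsMarkovKernel P]
    (rate : E → ℝ) : Prop :=
  ∀ x, ∀ᵐ ω ∂(jumpKernel P x), Filter.Tendsto (jumpTime rate ω) Filter.atTop Filter.atTop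

/-- `w`, restricted to `[0, ∞)`, is right-continuous and piecewise constant with finitely many
jumps in every bounded time interval: it is constant on each of the intervals `[T n, T (n + 1))`
of a partition of `[0, ∞)` by times `0 = T 0 < T 1 < ⋯` tending to infinity. -/
def IsJumpPath {E : Type*} (w : ℝ → E) : Prop :=
  ∃ T : ℕ → ℝ, T 0 = 0 ∧ StrictMono T ∧ Filter.Tendsto T Filter.atTop Filter.atTop ∧
    ∀ n, ∀ t ∈ Set.Ico (T n) (T (n + 1)), w t = w (T n)

/-! ### Restore processes whose interarrival dynamics is a jump process -/

/-- The randomness of one tour: the driving randomness of the interarrival process `Y`, and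
the independent variable `ξ ∼ Exp(1)` that determines the lifetime. -/
abbrev Life (E : Type*) := JumpSample E × ℝ

/-- The law of one tour, as a kernel in the starting point of `Y`. -/
def lifeKernel {E : Type*} [MeasurableSpace E] (P : Kernel E E) [IsMarkovKernel P] :
    Kernel E (Life E) :=
  jumpKernel P ×ₖ Kernel.const E (expMeasure 1)

instance {E : Type*} [MeasurableSpace E] (P : Kernel E E) [IsMarkovKernel P] :
    IsMarkovKernel (lifeKernel P) := by
  unfold lifeKernel; infer_instance

/-- The lifetime `inf {t ≥ 0 : ∫₀ᵗ κ(Y_s) ds ≥ ξ}`, with `inf ∅ = ∞`. -/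
def lifetime {E : Type*} (rate κ : E → ℝ) (l : Life E) : ENNReal :=
  sInf (ENNReal.ofReal '' {t : ℝ | 0 ≤ t ∧
    ENNReal.ofReal l.2 ≤ ∫⁻ s in Set.Ioc 0 t, ENNReal.ofReal (κ (jumpProcess rate l.1 s))})

/-- The first tour, followed by the sequence of the later tours. -/
abbrev Sample (E : Type*) := Life E × (ℕ → Life E)

/-- The `i`-th tour, `i = 0, 1, 2, …`. -/
def tour {E : Type*} (ω : Sample E) : ℕ → Life E
  | 0 => ω.1
  | i + 1 => ω.2 i

/-- The law `ℙ_x` of all tours, as a kernel in the starting point `x`: the first tour starts at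
`x`; the later tours are i.i.d., start from the regeneration distribution `ν`, and are
independent of the first one. -/
def restoreKernel {E : Type*} [MeasurableSpace E] (P : Kernel E E) [IsMarkovKernel P]
    (ν : Measure E) : Kernel E (Sample E) :=
  lifeKernel P ×ₖ Kernel.const E (Measure.infinitePi fun _ : ℕ => lifeKernel P ∘ₘ ν)

/-- The regeneration times `T₀ = 0`, `Tₙ = τ⁽⁰⁾ + ⋯ + τ⁽ⁿ⁻¹⁾`. -/
def regenTime {E : Type*} (rate κ : E → ℝ) (ω : Sample E) (n : ℕ) : ENNReal :=
  ∑ i ∈ Finset.range n, lifetime rate κ (tour ω i)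

/-- The index `i` of the tour that is under way at time `t`: `T_i ≤ t < T_{i+1}`. -/
def tourIndex {E : Type*} (rate κ : E → ℝ) (ω : Sample E) (t : ℝ) : ℕ :=
  sInf {i : ℕ | ENNReal.ofReal t < regenTime rate κ ω (i + 1)}

/-- The Restore process `X_t = ∑ᵢ 1_{[T_i, T_{i+1})}(t) Y⁽ⁱ⁾_{t - T_i}`. -/
def restoreProcess {E : Type*} (rate κ : E → ℝ) (t : ℝ) (ω : Sample E) : E :=
  jumpProcess rate (tour ω (tourIndex rate κ ω t)).1
    (t - (regenTime rate κ ω (tourIndex rate κ ω t)).toReal)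

/-- The regeneration rate
`κ(x) = (∫ π(y) λ(y) p(y,x) m(dy) - λ(x) π(x)) / π(x) + C μ(x) / π(x)`, with `rate = λ`. -/
def regenRate {E : Type*} [MeasurableSpace E] (m : Measure E) (p : E → E → ℝ)
    (rate π μ : E → ℝ) (C : ℝ) (x : E) : ℝ :=
  ((∫ y, π y * rate y * p y x ∂m) - rate x * π x) / π x + C * (μ x / π x)

/-! ### Markov processes and invariant distributions -/

/-- The natural filtration `σ(X_u : 0 ≤ u ≤ s)`. -/
abbrev pastSigma {E Ω : Type*} [MeasurableSpace E] (X : ℝ → Ω → E) (s : ℝ) : MeasurableSpace Ω :=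
  ⨆ u ∈ Set.Icc (0 : ℝ) s, MeasurableSpace.comap (X u) inferInstance

/-- `(X_t)_{t ≥ 0}` is a time-homogeneous Markov process under the laws `Pr x`, `x ∈ E`:
`X_0 = x` in law under `Pr x`, and given the past up to time `s`, the law of `X_{s+t}` is the
law of `X_t` under `Pr (X_s)`. -/
structure IsMarkovProcess {E Ω : Type*} [MeasurableSpace E] [MeasurableSpace Ω]
    (Pr : Kernel E Ω) (X : ℝ → Ω → E) : Prop where
  isMarkovKernel : IsMarkovKernel Pr
  measurable : ∀ t, 0 ≤ t → Measurable (X t)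
  initial : ∀ x, (Pr x).map (X 0) = Measure.dirac x
  markov : ∀ x s t, 0 ≤ s → 0 ≤ t → ∀ F, MeasurableSet[pastSigma X s] F →
    ∀ A, MeasurableSet A →
      Pr x (F ∩ X (s + t) ⁻¹' A) = ∫⁻ ω in F, Pr (X s ω) (X t ⁻¹' A) ∂(Pr x)

/-- `ν` is an invariant distribution: if the initial state has law `ν`, then so has `X_t` for
every `t ≥ 0`. -/
def IsInvariantDistribution {E Ω : Type*} [MeasurableSpace E] [MeasurableSpace Ω]
    (Pr : Kernel E Ω) (X : ℝ → Ω → E) (ν : Measure E) : Prop :=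
  IsProbabilityMeasure ν ∧ ∀ t, 0 ≤ t → (Pr ∘ₘ ν).map (X t) = ν

end

end Restore

namespace Restore

/-! The Restore process is itself a jump process. In state x two independent exponential clocks
compete: one of rate `rate x` for the next jump of the interarrival process, one of rate κ(x) for
the next regeneration. Hence the first event comes with total rate q = `rate` + κ, and the next
state is governed by the intensity kernel J(x, ·) = `rate x` • P(x, ·) + κ(x) • ν. Because the chain
is Markov and the exponential law has no memory, what follows the event is a fresh Restore sample
started at the new state. This is recorded by `FirstEventDecomposition` and established in
`firstEventDecomposition_restore`. The probabilistic half is `lintegral_first_event`, which rests on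
`lintegral_competing_clocks`; the pathwise half is `IsRegularSample.restoreProcess_add`, with
`ae_isRegularSample` for the absence of explosion.

Everything else uses the decomposition alone. The Markov property is proved on cylinder events by
induction on the number of events before time s (`lintegral_visits`), then extended by a π-λ
argument. Conditioning on the first event gives the backward equation for u_t(x) = P_x(X_t ∈ A),
whose time-integrated form is u_t + q ∫₀ᵗ u_s ds = 1_A + ∫₀ᵗ J u_s ds.

For invariance, multiply the definition of κ by π: this is the balance (`rate` + κ) π = ∫ π(y) `rate
y` p(y, ·) m(dy) + C μ. Integrating it gives ∫ κ π dm = C, so C μ is exactly the flux of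
regenerations and the balance reads πJ = qπ (`lintegral_eventKernel_eq`). Integrate the backward
equation against π: the two time integrals coincide and are finite since ∫ q π dm < ∞, so they
cancel and leave ∫ u_t dπ = π(A) (`lintegral_process_invariant`). Working with the time-integrated
equation requires neither a generator with its domain nor bounded rates. -/

/-! ### Prepending a term to an i.i.d. sequence -/

/-- The sequence `(x, z 0, z 1, …)`. -/
def consSeq {α : Type*} (x : α) (z : ℕ → α) : ℕ → α
  | 0 => x
  | n + 1 => z n

@[simp] lemma consSeq_zero {α : Type*} (x : α) (z : ℕ → α) : consSeq x z 0 = x := rfl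

@[simp] lemma consSeq_succ {α : Type*} (x : α) (z : ℕ → α) (n : ℕ) :
    consSeq x z (n + 1) = z n := rfl

@[fun_prop]
lemma measurable_consSeq {α β : Type*} [MeasurableSpace α] [MeasurableSpace β]
    {f : β → α} {g : β → ℕ → α} (hf : Measurable f) (hg : Measurable g) :
    Measurable fun b => consSeq (f b) (g b) := by
  refine measurable_pi_lambda _ fun n => ?_
  cases n with
  | zero => exact hf
  | succ n => exact (measurable_pi_apply n).comp hg

/-- The product measure is determined by finite boxes. The preimage of a box under `consSeq` is a
rectangle: a constraint on the new first term, if index 0 occurs in the box, times a box with all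
indices lowered by one. -/
lemma infinitePi_map_consSeq {α : Type*} [MeasurableSpace α] (ρ : Measure α)
    [IsProbabilityMeasure ρ] :
    (ρ.prod (Measure.infinitePi fun _ : ℕ => ρ)).map (fun p => consSeq p.1 p.2) =
      Measure.infinitePi fun _ : ℕ => ρ := by
  classical
  refine Measure.eq_infinitePi _ fun s t ht => ?_
  rw [Measure.map_apply (by fun_prop) (MeasurableSet.pi s.countable_toSet fun _ _ => ht _)]
  set s' : Finset ℕ := s.preimage Nat.succ Nat.succ_injective.injOn with hs'
  have h1 : (fun p : α × (ℕ → α) => consSeq p.1 p.2) ⁻¹' (Set.pi s t) =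
      (if 0 ∈ s then t 0 else Set.univ) ×ˢ Set.pi s' fun n => t (n + 1) := by
    ext p
    simp only [Set.mem_preimage, Set.mem_pi, Set.mem_prod, hs', Finset.coe_preimage,
      Finset.mem_coe]
    constructor
    · intro h
      refine ⟨?_, fun n hn => h (n + 1) hn⟩
      split_ifs with h0
      · exact h 0 h0
      · trivial
    · rintro ⟨h0, h⟩ n hn
      cases n with
      | zero => simpa [hn] using h0
      | succ n => exact h n hn
  rw [h1, Measure.prod_prod, Measure.infinitePi_pi _ fun i _ => ht _]
  have h2 : ∏ i ∈ s', ρ (t (i + 1)) = ∏ i ∈ s.erase 0, ρ (t i) := by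
    refine Finset.prod_bij (fun i _ => i + 1) ?_ ?_ ?_ ?_
    · intro i hi
      simpa [hs'] using hi
    · intro i _ j _ h
      simpa using h
    · intro i hi
      obtain ⟨h0, hi⟩ := Finset.mem_erase.1 hi
      obtain ⟨k, rfl⟩ := Nat.exists_eq_succ_of_ne_zero h0
      exact ⟨k, by simpa [hs'] using hi, rfl⟩
    · intros; rfl
  rw [h2]
  split_ifs with h0
  · rw [Finset.mul_prod_erase s (fun i => ρ (t i)) h0]
  · rw [measure_univ, one_mul, Finset.erase_eq_of_notMem h0]

lemma lintegral_infinitePi_consSeq {α : Type*} [MeasurableSpace α] (ρ : Measure α)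
    [IsProbabilityMeasure ρ] {F : (ℕ → α) → ENNReal} (hF : Measurable F) :
    ∫⁻ e, F e ∂Measure.infinitePi (fun _ : ℕ => ρ) =
      ∫⁻ a, ∫⁻ e, F (consSeq a e) ∂Measure.infinitePi (fun _ : ℕ => ρ) ∂ρ := by
  conv_lhs => rw [← infinitePi_map_consSeq ρ]
  rw [lintegral_map hF (by fun_prop), lintegral_prod _ (by fun_prop)]

/-! ### First-step decomposition of the discrete Markov chain -/

section Chain

variable {E : Type*} [MeasurableSpace E] (P : Kernel E E) [IsMarkovKernel P]

/-- The transition kernels of the Markov chain with kernel `P`, given the whole past. -/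
noncomputable abbrev pastKernel (n : ℕ) : Kernel ((i : Finset.Iic n) → E) E :=
  P.comap (fun h : (i : Finset.Iic n) → E => h ⟨n, Finset.mem_Iic.2 le_rfl⟩)
      (measurable_pi_apply _)

/-- The history up to time `n`, followed by `y`. -/
def snocHist {E : Type*} {n : ℕ} (h : (i : Finset.Iic n) → E) (y : E) :
    (i : Finset.Iic (n + 1)) → E :=
  fun i => if hi : i.1 ≤ n then h ⟨i.1, Finset.mem_Iic.2 hi⟩ else y

@[fun_prop]
lemma measurable_snocHist {β : Type*} [MeasurableSpace β] {n : ℕ}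
    {f : β → (i : Finset.Iic n) → E} {g : β → E} (hf : Measurable f) (hg : Measurable g) :
    Measurable fun b => snocHist (f b) (g b) := by
  refine measurable_pi_lambda _ fun i => ?_
  unfold snocHist
  by_cases hi : i.1 ≤ n
  · simp only [hi, dite_true]; fun_prop
  · simpa only [hi, dite_false] using hg

lemma lintegral_partialTraj_succ_self (n : ℕ) (h : (i : Finset.Iic n) → E)
    {G : ((i : Finset.Iic (n + 1)) → E) → ENNReal} (hG : Measurable G) :
    ∫⁻ k, G k ∂Kernel.partialTraj (X := fun _ => E) (pastKernel P) n (n + 1) h =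
      ∫⁻ y, G (snocHist h y) ∂P (h ⟨n, Finset.mem_Iic.2 le_rfl⟩) := by
  have hm := measurable_IicProdIoc (X := fun _ => E) (m := n) (n := n + 1)
  have hG' : Measurable fun p => G (IicProdIoc (X := fun _ => E) n (n + 1) p) := hG.comp hm
  rw [Kernel.partialTraj_succ_self, Kernel.lintegral_map _ hm _ hG,
    Kernel.lintegral_id_prod hG',
    Kernel.lintegral_map _ (by fun_prop) _ (hG'.of_uncurry_left (f := fun h l => G (IicProdIoc (X := fun _ => E) n (n + 1) (h, l)))),
    Kernel.lintegral_comap]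
  refine lintegral_congr fun y => congrArg G ?_
  ext i
  obtain ⟨i, hi⟩ := i
  simp only [IicProdIoc, snocHist]
  split_ifs with h
  · rfl
  · obtain rfl : i = n + 1 := by have := Finset.mem_Iic.1 hi; omega
    rfl

lemma lintegral_partialTraj_succ (n : ℕ) (h : (i : Finset.Iic 0) → E)
    {G : ((i : Finset.Iic (n + 1)) → E) → ENNReal} (hG : Measurable G) :
    ∫⁻ k, G k ∂Kernel.partialTraj (X := fun _ => E) (pastKernel P) 0 (n + 1) h =
      ∫⁻ k, ∫⁻ y, G (snocHist k y) ∂P (k ⟨n, Finset.mem_Iic.2 le_rfl⟩)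
        ∂Kernel.partialTraj (X := fun _ => E) (pastKernel P) 0 n h := by
  rw [Kernel.partialTraj_succ_eq_comp (X := fun _ => E) (κ := pastKernel P) (Nat.zero_le n), Kernel.lintegral_comp _ _ _ hG]
  simp_rw [lintegral_partialTraj_succ_self P n _ hG]

/-- The Markov chain started at `x` is determined by its initial law and its transitions. -/
lemma eq_chainKernel (η : Kernel E (ℕ → E))
    (h0 : ∀ x (g : E → ENNReal), Measurable g → ∫⁻ z, g (z 0) ∂η x = g x)
    (hs : ∀ x n (G : ((i : Finset.Iic (n + 1)) → E) → ENNReal), Measurable G →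
      ∫⁻ z, G (fun i => z i) ∂η x =
        ∫⁻ z, ∫⁻ y, G (snocHist (fun i => z i) y) ∂P (z n) ∂η x) :
    η = chainKernel P := by
  -- Uniqueness of the Ionescu-Tulcea extension: it suffices that all marginals on initial segments
  -- agree, which follows by induction from the initial law and the one-step transitions.
  have key : η.comap (fun h : (i : Finset.Iic 0) → E => h ⟨0, Finset.mem_Iic.2 le_rfl⟩)
      (measurable_pi_apply _) = Kernel.traj (X := fun _ => E) (pastKernel P) 0 := by
    refine Kernel.eq_traj (X := fun _ => E) (pastKernel P) _ fun b => ?_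
    induction b with
    | zero =>
      rw [Kernel.partialTraj_self]
      ext h : 1
      refine Measure.ext_of_lintegral _ fun G hG => ?_
      rw [Kernel.lintegral_map _ (by fun_prop) _ hG, Kernel.lintegral_comap,
        Kernel.id_apply, lintegral_dirac' _ hG]
      have := h0 (h ⟨0, Finset.mem_Iic.2 le_rfl⟩) (fun y => G fun _ => y) (by fun_prop)
      convert this using 2
      · ext z
        congr 1
        ext i
        obtain ⟨i, hi⟩ := i
        obtain rfl : i = 0 := by simpa using hi
        rfl
      · ext i
        obtain ⟨i, hi⟩ := i
        obtain rfl : i = 0 := by simpa using hi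
        rfl
    | succ n ih =>
      ext h : 1
      refine Measure.ext_of_lintegral _ fun G hG => ?_
      rw [lintegral_partialTraj_succ P n h hG, ← ih, Kernel.lintegral_map _ (by fun_prop) _ hG,
        Kernel.lintegral_map _ (by fun_prop) _ ?_, Kernel.lintegral_comap]
      · exact hs _ n G hG
      · have : Measurable fun p : ((i : Finset.Iic n) → E) × E => G (snocHist p.1 p.2) := by
          fun_prop
        exact Measurable.lintegral_kernel_prod_right' (κ := pastKernel P n) this
  ext x : 1
  unfold chainKernel
  rw [← key]
  rfl

lemma lintegral_chainKernel_zero (x : E) {g : E → ENNReal} (hg : Measurable g) :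
    ∫⁻ z, g (z 0) ∂chainKernel P x = g x := by
  have h := Kernel.traj_map_frestrictLe_apply (X := fun _ => E) (κ := pastKernel P) 0 0 (fun _ => x)
  rw [Kernel.partialTraj_self] at h
  unfold chainKernel
  rw [Kernel.comap_apply]
  calc _ = ∫⁻ k, g (k ⟨0, Finset.mem_Iic.2 le_rfl⟩)
        ∂((Kernel.traj (X := fun _ => E) (pastKernel P) 0 (fun _ => x)).map
          (Preorder.frestrictLe 0)) := by
        rw [lintegral_map (by fun_prop) (by fun_prop)]; rfl
    _ = _ := by
        rw [h, Kernel.id_apply, lintegral_dirac' _ (by fun_prop)]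

lemma lintegral_chainKernel_hist (x : E) (n : ℕ)
    {G : ((i : Finset.Iic (n + 1)) → E) → ENNReal} (hG : Measurable G) :
    ∫⁻ z, G (fun i => z i) ∂chainKernel P x =
        ∫⁻ z, ∫⁻ y, G (snocHist (fun i => z i) y) ∂P (z n) ∂chainKernel P x := by
  have h := Kernel.traj_map_frestrictLe_apply (X := fun _ => E) (κ := pastKernel P) 0 (n + 1)
    (fun _ => x)
  have h' := Kernel.traj_map_frestrictLe_apply (X := fun _ => E) (κ := pastKernel P) 0 n
    (fun _ => x)
  have hm : Measurable fun k : (i : Finset.Iic n) → E =>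
      ∫⁻ y, G (snocHist k y) ∂P (k ⟨n, Finset.mem_Iic.2 le_rfl⟩) := by
    have : Measurable fun p : ((i : Finset.Iic n) → E) × E => G (snocHist p.1 p.2) := by
      fun_prop
    exact Measurable.lintegral_kernel_prod_right' (κ := pastKernel P n) this
  have key := lintegral_partialTraj_succ P n (fun _ => x) hG
  rw [← h, ← h', lintegral_map hG (by fun_prop), lintegral_map hm (by fun_prop)] at key
  exact key

/-- First-step decomposition of the Markov chain. -/
lemma lintegral_chainKernel (x : E) {F : (ℕ → E) → ENNReal} (hF : Measurable F) :
    ∫⁻ z, F z ∂chainKernel P x = ∫⁻ y, ∫⁻ z, F (consSeq x z) ∂chainKernel P y ∂P x := by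
  -- The candidate law draws y from `P x`, runs the chain from y and prepends x. It is identified
  -- with the chain law by checking the two characterizing identities of `eq_chainKernel`.
  set η : Kernel E (ℕ → E) :=
    (Kernel.id ×ₖ (chainKernel P ∘ₖ P)).map fun p => consSeq p.1 p.2 with hη
  have hη' : ∀ x (F : (ℕ → E) → ENNReal), Measurable F →
      ∫⁻ z, F z ∂η x = ∫⁻ y, ∫⁻ z, F (consSeq x z) ∂chainKernel P y ∂P x := by
    intro x F hF
    rw [hη, Kernel.lintegral_map _ (by fun_prop) _ hF, Kernel.lintegral_id_prod (by fun_prop),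
      Kernel.lintegral_comp _ _ _ (by fun_prop)]
  have key : η = chainKernel P := by
    refine eq_chainKernel P η (fun x g hg => ?_) fun x n G hG => ?_
    · rw [hη' x _ (by fun_prop)]
      simp
    · have hm : Measurable fun z : ℕ → E => ∫⁻ y, G (snocHist (fun i => z i) y) ∂P (z n) := by
        have : Measurable fun p : (ℕ → E) × E => G (snocHist (n := n) (fun i => p.1 i) p.2) := by
          fun_prop
        exact Measurable.lintegral_kernel_prod_right'
          (κ := P.comap (fun z : ℕ → E => z n) (measurable_pi_apply n)) this
      rw [hη' x _ (by fun_prop), hη' x _ hm]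
      cases n with
      -- The first transition of the prepended path is the draw of y itself. All later ones are
      -- transitions of the chain from y, with indices lowered by one, so the two cases differ.
      | zero =>
        have hl : ∀ (y : E) (z : ℕ → E), (fun i : Finset.Iic (0 + 1) => consSeq x z i) =
            snocHist (n := 0) (fun _ => x) (z 0) := by
          intro y z
          ext i
          obtain ⟨i, hi⟩ := i
          simp only [snocHist]
          split_ifs with h
          · obtain rfl : i = 0 := by omega
            rfl
          · obtain rfl : i = 1 := by have := Finset.mem_Iic.1 hi; omega
            rfl
        have hr : ∀ z : ℕ → E, (fun i : Finset.Iic 0 => consSeq x z i) = fun _ => x := by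
          intro z
          ext i
          obtain ⟨i, hi⟩ := i
          obtain rfl : i = 0 := by simpa using hi
          rfl
        simp only [hl x, hr, consSeq_zero, lintegral_const, measure_univ, mul_one]
        refine lintegral_congr fun y => ?_
        exact lintegral_chainKernel_zero P y (g := fun y => G (snocHist (n := 0) (fun _ => x) y))
          (by fun_prop)
      | succ n =>
        refine lintegral_congr fun y => ?_
        -- The functional is rewritten as one of the history of the unprepended chain: index 0 reads
        -- x and index i reads the old index i - 1.
        have h := lintegral_chainKernel_hist P y n
          (G := fun h => G fun i => if hi : i.1 = 0 then x else
            h ⟨i.1 - 1, by have := Finset.mem_Iic.1 i.2; simp; omega⟩) (hG.comp (by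
              refine measurable_pi_lambda _ fun i => ?_
              by_cases hi : i.1 = 0
              · simp only [hi, dite_true]; fun_prop
              · simp only [hi, dite_false]; fun_prop))
        convert h using 2
        · ext z
          congr 1
          ext i
          obtain ⟨i, hi⟩ := i
          cases i with
          | zero => rfl
          | succ i => rfl
        · ext z
          refine lintegral_congr fun w => congrArg G ?_
          ext i
          obtain ⟨i, hi⟩ := i
          cases i with
          | zero => rfl
          | succ i => simp [snocHist]
  have := hη' x F hF
  rwa [key] at this

end Chain

/-! ### Exponential integrals and variation of constants -/

section ExponentialIntegrals

lemma lintegral_Ioi_shift (s : ℝ) (f : ℝ → ENNReal) :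
    ∫⁻ r in Set.Ioi s, f r = ∫⁻ r in Set.Ioi 0, f (s + r) := by
  have h : MeasurePreserving (fun r : ℝ => s + r) := measurePreserving_add_left volume s
  rw [← h.setLIntegral_comp_preimage_emb (measurableEmbedding_addLeft s)]
  congr 2
  ext r
  simp

lemma lintegral_Ioc_sub_left (t : ℝ) (f : ℝ → ENNReal) :
    ∫⁻ r in Set.Ioc 0 t, f (t - r) = ∫⁻ r in Set.Ioc 0 t, f r := by
  rw [setLIntegral_congr (Ico_ae_eq_Ioc (a := (0 : ℝ)) (b := t)).symm]
  have h : MeasurePreserving (fun r : ℝ => t - r) := Measure.measurePreserving_sub_left volume t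
  rw [← h.setLIntegral_comp_preimage_emb (MeasurableEquiv.subLeft t).measurableEmbedding _
    (Set.Ioc 0 t)]
  congr 2
  ext r
  simp [and_comm]

/-- An exponential clock of rate q either survives the interval from c to t or rings in it. The
additive form is free of subtraction in `ENNReal` and of division by q, which may be 0. -/
lemma exp_add_mul_lintegral_exp {q c t : ℝ} (hq : 0 ≤ q) (hct : c ≤ t) :
    ENNReal.ofReal (Real.exp (-(q * (t - c)))) +
      ENNReal.ofReal q * ∫⁻ s in Set.Ioc c t, ENNReal.ofReal (Real.exp (-(q * (s - c)))) = 1 := by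
  have hcont : Continuous fun s : ℝ => q * Real.exp (-(q * (s - c))) := by fun_prop
  rw [← lintegral_const_mul _ (by fun_prop)]
  simp_rw [← ENNReal.ofReal_mul hq]
  rw [← ofReal_integral_eq_lintegral_ofReal (hcont.integrableOn_Ioc)
    (Filter.Eventually.of_forall fun s => by positivity), ← intervalIntegral.integral_of_le hct,
    intervalIntegral.integral_eq_sub_of_hasDerivAt (f := fun s => -Real.exp (-(q * (s - c))))
      (fun s _ => ?_) (hcont.intervalIntegrable _ _), ← ENNReal.ofReal_add (by positivity)]
  · simp
  · simpa using mul_nonneg hq (sub_nonneg.2 hct)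
  · have := (((((hasDerivAt_id s).sub_const c).const_mul q).neg).exp).neg
    convert! this using 1
    simp; ring

/-- Integrated form of the linear equation `u' = -q u + w`, `u 0 = a`. -/
lemma add_mul_lintegral_of_variation_of_constants {q : ℝ} (hq : 0 ≤ q) (a : ENNReal)
    {u w : ℝ → ENNReal} (hw : Measurable w)
    (hu : ∀ s, 0 ≤ s → u s = ENNReal.ofReal (Real.exp (-(q * s))) * a +
      ∫⁻ v in Set.Ioc 0 s, ENNReal.ofReal (Real.exp (-(q * (s - v)))) * w v)
    {t : ℝ} (ht : 0 ≤ t) :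
    u t + ENNReal.ofReal q * ∫⁻ s in Set.Ioc 0 t, u s = a + ∫⁻ v in Set.Ioc 0 t, w v := by
  have hm : Measurable fun p : ℝ × ℝ =>
      ENNReal.ofReal (Real.exp (-(q * (p.1 - p.2)))) * w p.2 := by fun_prop
  have h1 : ∫⁻ s in Set.Ioc 0 t, u s =
      (∫⁻ s in Set.Ioc 0 t, ENNReal.ofReal (Real.exp (-(q * s))) * a) +
      ∫⁻ s in Set.Ioc 0 t, ∫⁻ v in Set.Ioc 0 t,
        (Set.Ici v).indicator (fun s => ENNReal.ofReal (Real.exp (-(q * (s - v)))) * w v) s := by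
    rw [← lintegral_add_left (by fun_prop)]
    refine setLIntegral_congr_fun measurableSet_Ioc fun s hs => ?_
    rw [hu s hs.1.le]
    congr 1
    rw [← lintegral_indicator measurableSet_Ioc, ← lintegral_indicator measurableSet_Ioc]
    refine lintegral_congr fun v => ?_
    simp only [Set.indicator_apply, Set.mem_Ioc, Set.mem_Ici]
    obtain ⟨hs0, hst⟩ := hs
    split_ifs <;> first | rfl | (exfalso; grind)
  -- Tonelli on the triangle v ≤ s ≤ t; the indicator lets both variables range over the same
  -- interval.
  have h2 : ∫⁻ s in Set.Ioc 0 t, ∫⁻ v in Set.Ioc 0 t,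
        (Set.Ici v).indicator (fun s => ENNReal.ofReal (Real.exp (-(q * (s - v)))) * w v) s =
      ∫⁻ v in Set.Ioc 0 t,
        (∫⁻ s in Set.Ioc v t, ENNReal.ofReal (Real.exp (-(q * (s - v))))) * w v := by
    rw [lintegral_lintegral_swap]
    · refine setLIntegral_congr_fun measurableSet_Ioc fun v hv => ?_
      rw [← lintegral_mul_const _ (by fun_prop), setLIntegral_congr Ioc_ae_eq_Icc,
        setLIntegral_congr (Ioc_ae_eq_Icc (a := v)), ← lintegral_indicator measurableSet_Icc,
        ← lintegral_indicator measurableSet_Icc]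
      refine lintegral_congr fun s => ?_
      simp only [Set.indicator_apply, Set.mem_Icc, Set.mem_Ici]
      obtain ⟨hv0, hvt⟩ := hv
      split_ifs <;> first | rfl | (exfalso; grind)
    · have : MeasurableSet {p : ℝ × ℝ | p.2 ≤ p.1} := measurableSet_le (by fun_prop) (by fun_prop)
      exact (hm.indicator this).aemeasurable
  have h3 : ENNReal.ofReal (Real.exp (-(q * t))) +
      ENNReal.ofReal q * ∫⁻ s in Set.Ioc 0 t, ENNReal.ofReal (Real.exp (-(q * s))) = 1 := by
    simpa using exp_add_mul_lintegral_exp hq ht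
  have h4 : Measurable fun v =>
      ∫⁻ s in Set.Ioc v t, ENNReal.ofReal (Real.exp (-(q * (s - v)))) := by
    have hS : MeasurableSet {p : ℝ × ℝ | p.1 < p.2 ∧ p.2 ≤ t} :=
      (measurableSet_lt measurable_fst measurable_snd).inter
        (measurableSet_le measurable_snd measurable_const)
    have hf : Measurable fun p : ℝ × ℝ => ENNReal.ofReal (Real.exp (-(q * (p.2 - p.1)))) := by
      fun_prop
    convert! (hf.indicator hS).lintegral_prod_right' (ν := volume) using 2 with v
    rw [← lintegral_indicator measurableSet_Ioc]
    rfl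
  rw [h1, h2, hu t ht, mul_add, add_add_add_comm]
  congr 1
  · rw [lintegral_mul_const _ (by fun_prop), ← mul_assoc, ← add_mul, h3, one_mul]
  · rw [← lintegral_const_mul _ (by fun_prop), ← lintegral_add_left (by fun_prop)]
    refine setLIntegral_congr_fun measurableSet_Ioc fun v hv => ?_
    rw [← mul_assoc, ← add_mul, exp_add_mul_lintegral_exp hq hv.2, one_mul]

end ExponentialIntegrals

/-! ### Processes decomposed at the first event: paths and loss of memory -/

section FirstEvent

variable {E Ω : Type*}

/-- The time of the `n`-th event, if `σ` is the time of the first event and `θ` is the shift of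
the sample to that time. -/
def eventTime (σ : Ω → ℝ) (θ : Ω → Ω) (n : ℕ) (ω : Ω) : ℝ :=
  ∑ k ∈ Finset.range n, σ (θ^[k] ω)

@[simp] lemma eventTime_zero (σ : Ω → ℝ) (θ : Ω → Ω) (ω : Ω) : eventTime σ θ 0 ω = 0 := by
  simp [eventTime]

lemma eventTime_succ (σ : Ω → ℝ) (θ : Ω → Ω) (n : ℕ) (ω : Ω) :
    eventTime σ θ (n + 1) ω = σ ω + eventTime σ θ n (θ ω) := by
  simp [eventTime, Finset.sum_range_succ', add_comm]

lemma eventTime_succ' (σ : Ω → ℝ) (θ : Ω → Ω) (n : ℕ) (ω : Ω) :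
    eventTime σ θ (n + 1) ω = eventTime σ θ n ω + σ (θ^[n] ω) := by
  simp [eventTime, Finset.sum_range_succ]

variable [MeasurableSpace E] [MeasurableSpace Ω]

@[fun_prop]
lemma measurable_eventTime {σ : Ω → ℝ} {θ : Ω → Ω} (hσ : Measurable σ) (hθ : Measurable θ)
    (n : ℕ) : Measurable (eventTime σ θ n) := by
  unfold eventTime
  exact Finset.measurable_sum _ fun k _ => hσ.comp (hθ.iterate k)

/-- The laws `Pr x` of a piecewise constant process `X` are decomposed at the first event: `X`
stays in its initial state `ζ` until the time `σ` of the first event, and then continues as the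
same process does on the shifted sample `θ ω`; under `Pr x`, the time `σ` and the shifted sample
`θ ω` are independent, and at time `r` the first event leads to the state `y` with
intensity `exp (- q x r) J x dy`. -/
structure FirstEventDecomposition (Pr : Kernel E Ω) (J : Kernel E E) (q : E → ℝ)
    (X : ℝ → Ω → E) (ζ : Ω → E) (σ : Ω → ℝ) (θ : Ω → Ω) (G : Set Ω) : Prop where
  measurable_process : Measurable fun p : ℝ × Ω => X p.1 p.2
  measurable_time : Measurable σ
  measurable_shift : Measurable θ
  ae_mem : ∀ x, ∀ᵐ ω ∂Pr x, ω ∈ G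
  shift_mem : ∀ ω ∈ G, θ ω ∈ G
  time_pos : ∀ ω ∈ G, 0 < σ ω
  process_eq_initial : ∀ ω ∈ G, ∀ t, 0 ≤ t → t < σ ω → X t ω = ζ ω
  process_shift : ∀ ω ∈ G, ∀ t, 0 ≤ t → X (σ ω + t) ω = X t (θ ω)
  exists_lt_eventTime : ∀ ω ∈ G, ∀ M, ∃ n, M < eventTime σ θ n ω
  law : ∀ x (Φ : E × ℝ × Ω → ENNReal), Measurable Φ →
    ∫⁻ ω, Φ (ζ ω, σ ω, θ ω) ∂Pr x =
      ∫⁻ r in Set.Ioi 0, ENNReal.ofReal (Real.exp (-(q x * r))) *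
        ∫⁻ y, ∫⁻ ω, Φ (x, r, ω) ∂Pr y ∂J x

namespace FirstEventDecomposition

variable {Pr : Kernel E Ω} [IsMarkovKernel Pr] {J : Kernel E E} {q : E → ℝ}
  {X : ℝ → Ω → E} {ζ : Ω → E} {σ : Ω → ℝ} {θ : Ω → Ω} {G : Set Ω}

lemma measurable_process_at (h : FirstEventDecomposition Pr J q X ζ σ θ G) (t : ℝ) :
    Measurable (X t) :=
  h.measurable_process.comp measurable_prodMk_left

lemma eventTime_nonneg (h : FirstEventDecomposition Pr J q X ζ σ θ G) (n : ℕ) :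
    ∀ ω ∈ G, 0 ≤ eventTime σ θ n ω := by
  induction n with
  | zero => simp
  | succ n ih =>
    intro ω hω
    rw [eventTime_succ]
    exact add_nonneg (h.time_pos ω hω).le (ih _ (h.shift_mem ω hω))

lemma process_eventTime_add (h : FirstEventDecomposition Pr J q X ζ σ θ G) (n : ℕ) :
    ∀ ω ∈ G, ∀ t, 0 ≤ t → X (eventTime σ θ n ω + t) ω = X t (θ^[n] ω) := by
  induction n with
  | zero => simp
  | succ n ih =>
    intro ω hω t ht
    rw [eventTime_succ, add_assoc, h.process_shift ω hω _
      (add_nonneg (h.eventTime_nonneg n _ (h.shift_mem ω hω)) ht), ih _ (h.shift_mem ω hω) t ht]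
    rfl

lemma iterate_mem (h : FirstEventDecomposition Pr J q X ζ σ θ G) (n : ℕ) {ω : Ω} (hω : ω ∈ G) :
    θ^[n] ω ∈ G := by
  induction n generalizing ω with
  | zero => exact hω
  | succ n ih => exact ih (h.shift_mem ω hω)

lemma isJumpPath (h : FirstEventDecomposition Pr J q X ζ σ θ G) {ω : Ω} (hω : ω ∈ G) :
    IsJumpPath fun t => X t ω := by
  have hmono : StrictMono fun n => eventTime σ θ n ω := by
    refine strictMono_nat_of_lt_succ fun n => ?_
    rw [eventTime_succ']
    linarith [h.time_pos _ (h.iterate_mem n hω)]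
  refine ⟨fun n => eventTime σ θ n ω, by simp, hmono, ?_, fun n t ht => ?_⟩
  · refine Filter.tendsto_atTop_atTop_of_monotone hmono.monotone fun M => ?_
    obtain ⟨n, hn⟩ := h.exists_lt_eventTime ω hω M
    exact ⟨n, hn.le⟩
  · simp only [Set.mem_Ico, eventTime_succ'] at ht
    have h1 := h.process_eventTime_add n ω hω (t - eventTime σ θ n ω) (by linarith)
    have h2 := h.process_eventTime_add n ω hω 0 le_rfl
    rw [add_sub_cancel] at h1
    rw [add_zero] at h2
    have hG := h.iterate_mem n hω
    change X t ω = X (eventTime σ θ n ω) ω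
    rw [h1, h2, h.process_eq_initial _ hG _ (by linarith) (by linarith),
      h.process_eq_initial _ hG _ le_rfl (h.time_pos _ hG)]

/-- The state at time `t`, if the first event takes place at time `r`, before it the state is `z`,
and the sample after it is `ω`. -/
noncomputable def stateAt (X : ℝ → Ω → E) (t : ℝ) (p : E × ℝ × Ω) : E :=
  if t < p.2.1 then p.1 else X (t - p.2.1) p.2.2

lemma measurable_stateAt (h : FirstEventDecomposition Pr J q X ζ σ θ G) (t : ℝ) :
    Measurable (stateAt X t) := by
  refine Measurable.ite (measurableSet_lt (by fun_prop) (by fun_prop)) (by fun_prop) ?_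
  exact h.measurable_process.comp (f := fun p : E × ℝ × Ω => (t - p.2.1, p.2.2)) (by fun_prop)

lemma process_eq_stateAt (h : FirstEventDecomposition Pr J q X ζ σ θ G) {ω : Ω} (hω : ω ∈ G)
    {t : ℝ} (ht : 0 ≤ t) : X t ω = stateAt X t (ζ ω, σ ω, θ ω) := by
  unfold stateAt
  split_ifs with h1
  · exact h.process_eq_initial ω hω t ht h1
  · rw [← h.process_shift ω hω _ (by simp only at h1 ⊢; linarith)]
    simp

/-- For a Φ that reads only the initial state, the right side of `law` cannot distinguish ζ from the
constant x. -/
lemma lintegral_initial (h : FirstEventDecomposition Pr J q X ζ σ θ G) (x : E)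
    {φ : E → ENNReal} (hφ : Measurable φ) : ∫⁻ ω, φ (ζ ω) ∂Pr x = φ x := by
  have h1 := h.law x (fun p => φ p.1) (by fun_prop)
  have h2 := h.law x (fun p => φ x) (by fun_prop)
  simp only at h1 h2
  rw [h1, ← h2]
  simp

lemma lintegral_process_zero (h : FirstEventDecomposition Pr J q X ζ σ θ G) (x : E)
    {φ : E → ENNReal} (hφ : Measurable φ) : ∫⁻ ω, φ (X 0 ω) ∂Pr x = φ x := by
  rw [← h.lintegral_initial x hφ]
  refine lintegral_congr_ae ?_
  filter_upwards [h.ae_mem x] with ω hω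
  rw [h.process_eq_initial ω hω 0 le_rfl (h.time_pos ω hω)]

lemma map_process_zero (h : FirstEventDecomposition Pr J q X ζ σ θ G) (x : E) :
    (Pr x).map (X 0) = Measure.dirac x := by
  refine Measure.ext_of_lintegral _ fun φ hφ => ?_
  rw [lintegral_map hφ (h.measurable_process_at 0), h.lintegral_process_zero x hφ,
    lintegral_dirac' _ hφ]

lemma lintegral_process (h : FirstEventDecomposition Pr J q X ζ σ θ G) (x : E)
    {φ : E → ENNReal} (hφ : Measurable φ) {t : ℝ} (ht : 0 ≤ t) :
    ∫⁻ ω, φ (X t ω) ∂Pr x =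
      ∫⁻ r in Set.Ioi 0, ENNReal.ofReal (Real.exp (-(q x * r))) *
        ∫⁻ y, ∫⁻ ω, φ (stateAt X t (x, r, ω)) ∂Pr y ∂J x := by
  rw [← h.law x (fun p => φ (stateAt X t p)) (hφ.comp (h.measurable_stateAt t))]
  refine lintegral_congr_ae ?_
  filter_upwards [h.ae_mem x] with ω hω
  rw [h.process_eq_stateAt hω ht]

/-- Loss of memory before the first event. -/
lemma lintegral_process_before (h : FirstEventDecomposition Pr J q X ζ σ θ G) (x : E)
    {φ : E → ENNReal} (hφ : Measurable φ) {S : Set E} (hS : MeasurableSet S) {s t : ℝ}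
    (hs : 0 ≤ s) (ht : 0 ≤ t) :
    ∫⁻ ω, {ω | s < σ ω ∧ ζ ω ∈ S}.indicator (fun ω => φ (X (s + t) ω)) ω ∂Pr x =
      ENNReal.ofReal (Real.exp (-(q x * s))) *
        S.indicator (fun x => ∫⁻ ω, φ (X t ω) ∂Pr x) x := by
  classical
  have h0 : MeasurableSet {p : E × ℝ × Ω | s < p.2.1} :=
    measurableSet_lt measurable_const (by fun_prop)
  have hm : Measurable fun p : E × ℝ × Ω =>
      {p : E × ℝ × Ω | s < p.2.1 ∧ p.1 ∈ S}.indicator (fun p => φ (stateAt X (s + t) p)) p :=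
    (hφ.comp (h.measurable_stateAt _)).indicator (h0.inter (measurable_fst hS))
  have h1 := h.law x _ hm
  have h2 : ∫⁻ ω, {ω | s < σ ω ∧ ζ ω ∈ S}.indicator (fun ω => φ (X (s + t) ω)) ω ∂Pr x =
      ∫⁻ ω, {p : E × ℝ × Ω | s < p.2.1 ∧ p.1 ∈ S}.indicator (fun p => φ (stateAt X (s + t) p))
        (ζ ω, σ ω, θ ω) ∂Pr x := by
    refine lintegral_congr_ae ?_
    filter_upwards [h.ae_mem x] with ω hω
    simp only [Set.indicator_apply, Set.mem_ofPred_eq]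
    rw [h.process_eq_stateAt hω (add_nonneg hs ht)]
  rw [h2, h1]
  by_cases hx : x ∈ S
  · have h3 : ∫⁻ r in Set.Ioi 0, ENNReal.ofReal (Real.exp (-(q x * r))) *
        (∫⁻ y, ∫⁻ ω, {p : E × ℝ × Ω | s < p.2.1 ∧ p.1 ∈ S}.indicator
          (fun p => φ (stateAt X (s + t) p)) (x, r, ω) ∂Pr y ∂J x) =
        ∫⁻ r in Set.Ioi s, ENNReal.ofReal (Real.exp (-(q x * r))) *
        (∫⁻ y, ∫⁻ ω, φ (stateAt X (s + t) (x, r, ω)) ∂Pr y ∂J x) := by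
      rw [← lintegral_indicator measurableSet_Ioi, ← lintegral_indicator measurableSet_Ioi]
      refine lintegral_congr fun r => ?_
      simp only [Set.indicator_apply, Set.mem_Ioi, Set.mem_ofPred_eq, hx, and_true]
      by_cases hr : s < r
      · simp [hr, hs.trans_lt hr]
      · simp [hr]
    -- Only the difference between the observation time and the event time matters. Shifting r by s
    -- therefore extracts the factor exp(-q s) and leaves the law of the state at time t.
    have h4 : ∀ r ω, stateAt X (s + t) (x, s + r, ω) = stateAt X t (x, r, ω) := by
      intro r ω
      simp [stateAt]
    rw [h3, lintegral_Ioi_shift, Set.indicator_of_mem hx, h.lintegral_process x hφ ht,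
      ← lintegral_const_mul' _ _ ENNReal.ofReal_ne_top]
    refine lintegral_congr fun r => ?_
    simp_rw [h4]
    rw [← mul_assoc, ← ENNReal.ofReal_mul (by positivity), ← Real.exp_add]
    ring_nf
  · simp [hx]

/-- The samples for which the process visits `B j` at the nonnegative times among the `u j`. -/
def visits {ι : Type*} (X : ℝ → Ω → E) (I : Finset ι) (u : ι → ℝ) (B : ι → Set E) : Set Ω :=
  {ω | ∀ j ∈ I, 0 ≤ u j → X (u j) ω ∈ B j}

/-- The samples for which exactly `n` events take place up to time `s`. -/
def eventCount (σ : Ω → ℝ) (θ : Ω → Ω) (n : ℕ) (s : ℝ) : Set Ω :=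
  {ω | eventTime σ θ n ω ≤ s ∧ s < eventTime σ θ (n + 1) ω}

/-- Joint measurability in the sample and the time shift is needed because `law` is applied with the
random shift σ. -/
lemma measurableSet_visits_sub {ι : Type*} (h : FirstEventDecomposition Pr J q X ζ σ θ G)
    (I : Finset ι) (u : ι → ℝ) {B : ι → Set E} (hB : ∀ j ∈ I, MeasurableSet (B j)) :
    MeasurableSet {p : ℝ × Ω | p.2 ∈ visits X I (fun j => u j - p.1) B} := by
  have h0 : {p : ℝ × Ω | p.2 ∈ visits X I (fun j => u j - p.1) B} =
      ⋂ j ∈ I, {p : ℝ × Ω | 0 ≤ u j - p.1 → X (u j - p.1) p.2 ∈ B j} := by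
    ext p
    simp [visits]
  rw [h0]
  refine Finset.measurableSet_biInter _ fun j hj => ?_
  have h1 : MeasurableSet {p : ℝ × Ω | 0 ≤ u j - p.1} :=
    measurableSet_le measurable_const (by fun_prop)
  have h2 : MeasurableSet {p : ℝ × Ω | X (u j - p.1) p.2 ∈ B j} :=
    h.measurable_process.comp (f := fun p : ℝ × Ω => (u j - p.1, p.2)) (by fun_prop) (hB j hj)
  convert! h1.compl.union h2 using 1
  ext p
  simp [imp_iff_not_or]

lemma measurableSet_visits {ι : Type*} (h : FirstEventDecomposition Pr J q X ζ σ θ G)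
    (I : Finset ι) (u : ι → ℝ) {B : ι → Set E} (hB : ∀ j ∈ I, MeasurableSet (B j)) :
    MeasurableSet (visits X I u B) := by
  have := measurable_prodMk_left (x := (0 : ℝ)) (h.measurableSet_visits_sub I u hB)
  simpa using this

lemma measurableSet_eventCount_sub (h : FirstEventDecomposition Pr J q X ζ σ θ G) (n : ℕ)
    (s : ℝ) : MeasurableSet {p : ℝ × Ω | p.2 ∈ eventCount σ θ n (s - p.1)} := by
  have := h.measurable_time
  have := h.measurable_shift
  have h1 : MeasurableSet {p : ℝ × Ω | eventTime σ θ n p.2 ≤ s - p.1} :=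
    measurableSet_le (by fun_prop) (by fun_prop)
  have h2 : MeasurableSet {p : ℝ × Ω | s - p.1 < eventTime σ θ (n + 1) p.2} :=
    measurableSet_lt (by fun_prop) (by fun_prop)
  exact h1.inter h2

lemma measurableSet_eventCount (h : FirstEventDecomposition Pr J q X ζ σ θ G) (n : ℕ) (s : ℝ) :
    MeasurableSet (eventCount σ θ n s) := by
  have := measurable_prodMk_left (x := (0 : ℝ)) (h.measurableSet_eventCount_sub n s)
  simpa using this

/-- Before the first event the path is constant, so the constraints on the past become a constraint
on the initial state, and `lintegral_process_before` applies. -/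
lemma lintegral_visits_zero {ι : Type*} (h : FirstEventDecomposition Pr J q X ζ σ θ G) (x : E)
    (I : Finset ι) {u : ι → ℝ} {B : ι → Set E} (hB : ∀ j ∈ I, MeasurableSet (B j))
    {φ : E → ENNReal} (hφ : Measurable φ) {s t : ℝ} (hs : 0 ≤ s) (hu : ∀ j ∈ I, u j ≤ s)
    (ht : 0 ≤ t) :
    ∫⁻ ω, (visits X I u B ∩ eventCount σ θ 0 s).indicator (fun ω => φ (X (s + t) ω)) ω ∂Pr x =
      ENNReal.ofReal (Real.exp (-(q x * s))) *
        {x | ∀ j ∈ I, 0 ≤ u j → x ∈ B j}.indicator (fun x => ∫⁻ ω, φ (X t ω) ∂Pr x) x := by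
  classical
  have hS : MeasurableSet {x | ∀ j ∈ I, 0 ≤ u j → x ∈ B j} := by
    simp only [Set.ofPred_forall]
    exact Finset.measurableSet_biInter _ fun j hj => MeasurableSet.iInter fun _ => hB j hj
  rw [← h.lintegral_process_before x hφ hS hs ht]
  refine lintegral_congr_ae ?_
  filter_upwards [h.ae_mem x] with ω hω
  have : ω ∈ visits X I u B ∩ eventCount σ θ 0 s ↔
      ω ∈ {ω | s < σ ω ∧ ζ ω ∈ {x | ∀ j ∈ I, 0 ≤ u j → x ∈ B j}} := by
    simp only [visits, eventCount, Set.mem_inter_iff, Set.mem_ofPred_eq, eventTime_zero, hs,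
      true_and, eventTime_succ, add_zero]
    rw [and_comm]
    refine and_congr_right fun hσ => forall₃_congr fun j hj hj0 => ?_
    rw [h.process_eq_initial ω hω _ hj0 ((hu j hj).trans_lt hσ)]
  by_cases hc : ω ∈ visits X I u B ∩ eventCount σ θ 0 s
  · rw [Set.indicator_of_mem hc]
    exact (Set.indicator_of_mem (this.1 hc) fun ω => φ (X (s + t) ω)).symm
  · rw [Set.indicator_of_notMem hc]
    exact (Set.indicator_of_notMem (mt this.2 hc) fun ω => φ (X (s + t) ω)).symm

/-- Conditioning on the time r of the first event: constraints at times before r concern the initial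
state x, and the others are passed on to the shifted sample at times lowered by r. Constraints
already settled then sit at negative times, which `visits` ignores. -/
lemma lintegral_visits_succ {ι : Type*} (h : FirstEventDecomposition Pr J q X ζ σ θ G) (x : E)
    (I : Finset ι) {u : ι → ℝ} {B : ι → Set E} (hB : ∀ j ∈ I, MeasurableSet (B j))
    {φ : E → ENNReal} (hφ : Measurable φ) {s t : ℝ} (ht : 0 ≤ t) (n : ℕ) :
    ∫⁻ ω, (visits X I u B ∩ eventCount σ θ (n + 1) s).indicator
        (fun ω => φ (X (s + t) ω)) ω ∂Pr x =
      ∫⁻ r in Set.Ioi 0, ENNReal.ofReal (Real.exp (-(q x * r))) *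
        ∫⁻ y, {_y : E | r ≤ s ∧ ∀ j ∈ I, 0 ≤ u j → u j < r → x ∈ B j}.indicator (fun y =>
          ∫⁻ ω, (visits X I (fun j => u j - r) B ∩ eventCount σ θ n (s - r)).indicator
            (fun ω => φ (X (s - r + t) ω)) ω ∂Pr y) y ∂J x := by
  -- `D` collects the conditions decided by the initial state and the event time, `D'` those on the
  -- sample after the event.
  set D : Set (E × ℝ × Ω) := {p | p.2.1 ≤ s ∧ ∀ j ∈ I, 0 ≤ u j → u j < p.2.1 → p.1 ∈ B j} with hD
  set D' : Set (E × ℝ × Ω) := {p | p.2.2 ∈ visits X I (fun j => u j - p.2.1) B ∧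
    p.2.2 ∈ eventCount σ θ n (s - p.2.1)} with hD'
  have hDm : MeasurableSet D := by
    have h0 : MeasurableSet {p : E × ℝ × Ω | p.2.1 ≤ s} :=
      measurableSet_le (by fun_prop) measurable_const
    suffices h1 : MeasurableSet
        {p : E × ℝ × Ω | ∀ j ∈ I, 0 ≤ u j → u j < p.2.1 → p.1 ∈ B j} from h0.inter h1
    simp only [Set.ofPred_forall]
    refine Finset.measurableSet_biInter _ fun j hj => MeasurableSet.iInter fun _ => ?_
    have h1 : MeasurableSet {p : E × ℝ × Ω | u j < p.2.1} :=
      measurableSet_lt measurable_const (by fun_prop)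
    convert! h1.compl.union (measurable_fst (hB j hj)) using 1
    ext p
    simp [imp_iff_not_or]
  have hDm' : MeasurableSet D' :=
    (measurable_snd (h.measurableSet_visits_sub I u hB)).inter
      (measurable_snd (h.measurableSet_eventCount_sub n s))
  have hφm : Measurable fun p : E × ℝ × Ω => φ (X (s - p.2.1 + t) p.2.2) :=
    hφ.comp (h.measurable_process.comp (f := fun p : E × ℝ × Ω => (s - p.2.1 + t, p.2.2))
      (by fun_prop))
  have hm := (hφm.indicator hDm').indicator hDm
  have h1 : ∫⁻ ω, (visits X I u B ∩ eventCount σ θ (n + 1) s).indicator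
        (fun ω => φ (X (s + t) ω)) ω ∂Pr x =
      ∫⁻ ω, D.indicator (D'.indicator fun p => φ (X (s - p.2.1 + t) p.2.2))
        (ζ ω, σ ω, θ ω) ∂Pr x := by
    refine lintegral_congr_ae ?_
    filter_upwards [h.ae_mem x] with ω hω
    rw [Set.indicator_indicator]
    have hmem : ω ∈ visits X I u B ∩ eventCount σ θ (n + 1) s ↔ (ζ ω, σ ω, θ ω) ∈ D ∩ D' := by
      have hn := h.eventTime_nonneg n _ (h.shift_mem ω hω)
      simp only [visits, eventCount, Set.mem_inter_iff, Set.mem_ofPred_eq, eventTime_succ σ θ n ω,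
        eventTime_succ σ θ (n + 1) ω, hD, hD', sub_nonneg]
      constructor
      · rintro ⟨hv, hs1, hs2⟩
        refine ⟨⟨by linarith, fun j hj hj0 hjσ => ?_⟩, fun j hj hjσ => ?_, by linarith, by linarith⟩
        · rw [← h.process_eq_initial ω hω _ hj0 hjσ]
          exact hv j hj hj0
        · rw [← h.process_shift ω hω _ (by linarith), add_sub_cancel]
          exact hv j hj ((h.time_pos ω hω).le.trans hjσ)
      · rintro ⟨⟨hσs, hv⟩, hv', hs1, hs2⟩
        refine ⟨fun j hj hj0 => ?_, by linarith, by linarith⟩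
        rcases lt_or_ge (u j) (σ ω) with hjσ | hjσ
        · rw [h.process_eq_initial ω hω _ hj0 hjσ]
          exact hv j hj hj0 hjσ
        · have := hv' j hj hjσ
          rwa [← h.process_shift ω hω _ (by linarith), add_sub_cancel] at this
    by_cases hc : ω ∈ visits X I u B ∩ eventCount σ θ (n + 1) s
    · rw [Set.indicator_of_mem hc, Set.indicator_of_mem (hmem.1 hc)]
      have hσs : σ ω ≤ s := (hmem.1 hc).1.1
      rw [← h.process_shift ω hω _ (by simp only; linarith)]
      congr 2
      simp only
      ring
    · rw [Set.indicator_of_notMem hc, Set.indicator_of_notMem (mt hmem.2 hc)]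
  rw [h1, h.law x _ hm]
  refine lintegral_congr fun r => ?_
  congr 1
  refine lintegral_congr fun y => ?_
  by_cases hr : r ≤ s ∧ ∀ j ∈ I, 0 ≤ u j → u j < r → x ∈ B j
  · rw [Set.indicator_of_mem (by exact hr)]
    refine lintegral_congr fun ω => ?_
    rw [Set.indicator_of_mem (by exact hr)]
    rfl
  · rw [Set.indicator_of_notMem (by exact hr)]
    rw [← lintegral_zero (μ := Pr y)]
    refine lintegral_congr fun ω => ?_
    rw [Set.indicator_of_notMem (by exact hr)]

/-- The Markov property, on the event that `n` events take place up to time `s`. -/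
lemma lintegral_visits {ι : Type*} (h : FirstEventDecomposition Pr J q X ζ σ θ G)
    (I : Finset ι) {B : ι → Set E} (hB : ∀ j ∈ I, MeasurableSet (B j))
    {φ : E → ENNReal} (hφ : Measurable φ) {t : ℝ} (ht : 0 ≤ t) (n : ℕ) :
    ∀ (x : E) (s : ℝ), 0 ≤ s → ∀ u : ι → ℝ, (∀ j ∈ I, u j ≤ s) →
    ∫⁻ ω, (visits X I u B ∩ eventCount σ θ n s).indicator (fun ω => φ (X (s + t) ω)) ω ∂Pr x =
      ∫⁻ ω, (visits X I u B ∩ eventCount σ θ n s).indicator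
        (fun ω => ∫⁻ ω', φ (X t ω') ∂Pr (X s ω)) ω ∂Pr x := by
  classical
  have hg : Measurable fun x => ∫⁻ ω', φ (X t ω') ∂Pr x :=
    (hφ.comp (h.measurable_process_at t)).lintegral_kernel
  induction n with
  | zero =>
    intro x s hs u hu
    -- The right side is treated by the same formula, with the function y ↦ E_y φ(X_t) in place of φ
    -- and with t = 0; both sides then reduce to the same expression. The induction step repeats
    -- this.
    have h1 := h.lintegral_visits_zero x I hB hg hs hu le_rfl
    rw [add_zero] at h1
    rw [h.lintegral_visits_zero x I hB hφ hs hu ht, h1]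
    simp only [Set.indicator_apply]
    rw [h.lintegral_process_zero x hg]
  | succ n ih =>
    intro x s hs u hu
    have h1 := h.lintegral_visits_succ x I (u := u) (s := s) hB hg le_rfl n
    rw [add_zero] at h1
    rw [h.lintegral_visits_succ x I hB hφ ht n, h1]
    refine lintegral_congr fun r => ?_
    congr 1
    refine lintegral_congr fun y => ?_
    simp only [Set.indicator_apply, Set.mem_ofPred_eq]
    split_ifs with hr
    · have := ih y (s - r) (by linarith [hr.1]) (fun j => u j - r)
        (fun j hj => by linarith [hu j hj])
      simpa only [Set.indicator_apply, add_zero] using this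
    · rfl

end FirstEventDecomposition
end FirstEvent

/-! ### Markov property, backward equation and invariance -/

section FirstEvent

variable {E Ω : Type*} [MeasurableSpace E] [MeasurableSpace Ω]

namespace FirstEventDecomposition

variable {Pr : Kernel E Ω} [IsMarkovKernel Pr] {J : Kernel E E} {q : E → ℝ}
  {X : ℝ → Ω → E} {ζ : Ω → E} {σ : Ω → ℝ} {θ : Ω → Ω} {G : Set Ω}

lemma exists_mem_eventCount (h : FirstEventDecomposition Pr J q X ζ σ θ G) {ω : Ω} (hω : ω ∈ G)
    {s : ℝ} (hs : 0 ≤ s) : ∃ n, ω ∈ eventCount σ θ n s := by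
  classical
  have hex := h.exists_lt_eventTime ω hω s
  obtain ⟨k, hk⟩ : ∃ k, Nat.find hex = k + 1 := by
    refine Nat.exists_eq_succ_of_ne_zero fun h0 => ?_
    have := Nat.find_spec hex
    rw [h0, eventTime_zero] at this
    linarith
  refine ⟨k, not_lt.1 (Nat.find_min hex (m := k) (by omega)), ?_⟩
  rw [← hk]
  exact Nat.find_spec hex

lemma disjoint_eventCount (h : FirstEventDecomposition Pr J q X ζ σ θ G) {ω : Ω} (hω : ω ∈ G)
    {s : ℝ} {m n : ℕ} (hm : ω ∈ eventCount σ θ m s) (hn : ω ∈ eventCount σ θ n s) : m = n := by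
  have hmono : Monotone fun n => eventTime σ θ n ω := by
    refine monotone_nat_of_le_succ fun n => ?_
    rw [eventTime_succ']
    linarith [h.time_pos _ (h.iterate_mem n hω)]
  by_contra hne
  rcases lt_or_gt_of_ne hne with hlt | hlt
  · have : eventTime σ θ (m + 1) ω ≤ eventTime σ θ n ω := hmono hlt
    linarith [hm.2, hn.1]
  · have : eventTime σ θ (n + 1) ω ≤ eventTime σ θ m ω := hmono hlt
    linarith [hm.1, hn.2]

/-- On good samples the events "exactly n events up to time s" form a partition, by positivity of
the waiting times and absence of explosion. -/
lemma lintegral_indicator_eq_tsum_eventCount (h : FirstEventDecomposition Pr J q X ζ σ θ G)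
    (x : E) {V : Set Ω} (hV : MeasurableSet V) {s : ℝ} (hs : 0 ≤ s) {f : Ω → ENNReal}
    (hf : Measurable f) :
    ∫⁻ ω, V.indicator f ω ∂Pr x =
      ∑' n, ∫⁻ ω, (V ∩ eventCount σ θ n s).indicator f ω ∂Pr x := by
  rw [← lintegral_tsum fun n =>
    (hf.indicator (hV.inter (h.measurableSet_eventCount n s))).aemeasurable]
  refine lintegral_congr_ae ?_
  filter_upwards [h.ae_mem x] with ω hω
  obtain ⟨n, hn⟩ := h.exists_mem_eventCount hω hs
  rw [tsum_eq_single n]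
  · by_cases hc : ω ∈ V
    · have hc' : ω ∈ V ∩ eventCount σ θ n s := ⟨hc, hn⟩
      rw [Set.indicator_of_mem hc, Set.indicator_of_mem hc']
    · rw [Set.indicator_of_notMem hc, Set.indicator_of_notMem fun hc' => hc hc'.1]
  · intro m hm
    exact Set.indicator_of_notMem (fun hc => hm (h.disjoint_eventCount hω hc.2 hn)) _

lemma pastSigma_le (h : FirstEventDecomposition Pr J q X ζ σ θ G) (s : ℝ) :
    pastSigma X s ≤ (inferInstance : MeasurableSpace Ω) :=
  iSup₂_le fun u _ => (h.measurable_process_at u).comap_le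

/-- The Markov property on cylinder events: sum `lintegral_visits` over the number of events up to
time s. -/
lemma measure_visits_inter (h : FirstEventDecomposition Pr J q X ζ σ θ G) (x : E) {s t : ℝ}
    (hs : 0 ≤ s) (ht : 0 ≤ t) {ι : Type*} (I : Finset ι) {u : ι → ℝ} (hu : ∀ j ∈ I, u j ≤ s)
    {B : ι → Set E} (hB : ∀ j ∈ I, MeasurableSet (B j)) {A : Set E} (hA : MeasurableSet A) :
    Pr x (visits X I u B ∩ X (s + t) ⁻¹' A) =
      ∫⁻ ω in visits X I u B, Pr (X s ω) (X t ⁻¹' A) ∂(Pr x) := by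
  have hA1 : MeasurableSet (X (s + t) ⁻¹' A) := h.measurable_process_at _ hA
  have hA2 : MeasurableSet (X t ⁻¹' A) := h.measurable_process_at _ hA
  have hg : Measurable fun ω => Pr (X s ω) (X t ⁻¹' A) :=
    (Kernel.measurable_coe Pr hA2).comp (h.measurable_process_at s)
  have hVm := h.measurableSet_visits I u hB
  have hφ : Measurable (A.indicator (1 : E → ENNReal)) := measurable_one.indicator hA
  have hφX : Measurable fun ω => A.indicator (1 : E → ENNReal) (X (s + t) ω) :=
    hφ.comp (h.measurable_process_at _)
  have e1 : Pr x (visits X I u B ∩ X (s + t) ⁻¹' A) =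
      ∫⁻ ω, (visits X I u B).indicator
        (fun ω => A.indicator (1 : E → ENNReal) (X (s + t) ω)) ω ∂Pr x := by
    rw [lintegral_indicator hVm, Set.inter_comm, ← Measure.restrict_apply hA1,
      ← lintegral_indicator_one hA1]
    rfl
  have e2 : ∀ y, Pr y (X t ⁻¹' A) = ∫⁻ ω, A.indicator (1 : E → ENNReal) (X t ω) ∂Pr y := by
    intro y
    rw [← lintegral_indicator_one hA2]
    rfl
  rw [e1, ← lintegral_indicator hVm,
    h.lintegral_indicator_eq_tsum_eventCount x hVm hs hφX,
    h.lintegral_indicator_eq_tsum_eventCount x hVm hs hg]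
  refine tsum_congr fun n => ?_
  simp_rw [e2]
  exact h.lintegral_visits I hB hφ ht n x s hs u hu

/-- Cylinder events form a π-system generating the past, and both sides are countably additive in F,
so the identity extends by the π-λ theorem. -/
lemma markov_property (h : FirstEventDecomposition Pr J q X ζ σ θ G) (x : E) {s t : ℝ}
    (hs : 0 ≤ s) (ht : 0 ≤ t) {F : Set Ω} (hF : MeasurableSet[pastSigma X s] F) {A : Set E}
    (hA : MeasurableSet A) :
    Pr x (F ∩ X (s + t) ⁻¹' A) = ∫⁻ ω in F, Pr (X s ω) (X t ⁻¹' A) ∂(Pr x) := by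
  have hA1 : MeasurableSet (X (s + t) ⁻¹' A) := h.measurable_process_at _ hA
  have hgen : pastSigma X s = MeasurableSpace.generateFrom
      (piiUnionInter (fun u => {S | MeasurableSet[MeasurableSpace.comap (X u) inferInstance] S})
        (Set.Icc 0 s)) :=
    (generateFrom_piiUnionInter_measurableSet _ _).symm
  have hpi : IsPiSystem
      (piiUnionInter (fun u => {S | MeasurableSet[MeasurableSpace.comap (X u) inferInstance] S})
        (Set.Icc 0 s)) :=
    isPiSystem_piiUnionInter _
      (fun u => @MeasurableSpace.isPiSystem_measurableSet _ (MeasurableSpace.comap (X u) _)) _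
  -- An empty family of constraints gives the identity for the whole space, from which complements
  -- are obtained by cancelling a finite term.
  have huniv : Pr x (X (s + t) ⁻¹' A) = ∫⁻ ω, Pr (X s ω) (X t ⁻¹' A) ∂Pr x := by
    have := h.measure_visits_inter x hs ht (∅ : Finset ℕ) (u := fun _ => 0) (B := fun _ => ∅)
      (by simp) (by simp) hA
    simpa [visits] using this
  induction F, hF using MeasurableSpace.induction_on_inter hgen hpi with
  | empty => simp
  | basic F hF =>
    obtain ⟨I, hI, f, hf, rfl⟩ := hF
    have hf' : ∀ u, ∃ B : Set E, MeasurableSet B ∧ (u ∈ I → f u = X u ⁻¹' B) := by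
      intro u
      by_cases hu : u ∈ I
      · obtain ⟨B, hB, hBf⟩ := hf u hu
        exact ⟨B, hB, fun _ => hBf.symm⟩
      · exact ⟨∅, .empty, fun hu' => absurd hu' hu⟩
    choose B hB hBf using hf'
    have hV : ⋂ u ∈ I, f u = visits X I id B := by
      ext ω
      simp only [Set.mem_iInter, visits, Set.mem_ofPred_eq, id]
      refine forall₂_congr fun u hu => ?_
      rw [hBf u hu]
      simp [(hI hu).1]
    rw [hV]
    exact h.measure_visits_inter x hs ht I (fun j hj => (hI hj).2) (fun j _ => hB j) hA
  | compl F hF ih =>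
    have hF' := h.pastSigma_le s F hF
    have h1 := measure_inter_add_sdiff (μ := Pr x) (X (s + t) ⁻¹' A) hF'
    have h2 := lintegral_add_compl (μ := Pr x) (fun ω => Pr (X s ω) (X t ⁻¹' A)) hF'
    rw [Set.inter_comm, ih] at h1
    rw [← huniv, ← h1] at h2
    rw [Set.inter_comm, ← Set.sdiff_eq]
    refine (ENNReal.add_right_inj ?_).1 h2.symm
    rw [← ih]
    exact measure_ne_top _ _
  | iUnion F hd hF ih =>
    have hF' := fun i => h.pastSigma_le s (F i) (hF i)
    rw [Set.iUnion_inter, measure_iUnion _ fun i => (hF' i).inter hA1,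
      lintegral_iUnion hF' hd]
    · exact tsum_congr ih
    · exact fun i j hij => (hd hij).mono Set.inter_subset_left Set.inter_subset_left

lemma isMarkovProcess (h : FirstEventDecomposition Pr J q X ζ σ θ G) : IsMarkovProcess Pr X where
  isMarkovKernel := inferInstance
  measurable t _ := h.measurable_process_at t
  initial := h.map_process_zero
  markov x _ _ hs ht _ hF _ hA := h.markov_property x hs ht hF hA

/-- The density of the first event time has total mass one. This normalization links q to the total
mass of J and evaluates the term without events in the backward equation. -/
lemma lintegral_law_one (h : FirstEventDecomposition Pr J q X ζ σ θ G) (x : E) :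
    (∫⁻ r in Set.Ioi 0, ENNReal.ofReal (Real.exp (-(q x * r)))) * J x Set.univ = 1 := by
  have := h.law x (fun _ => 1) measurable_const
  simp only [lintegral_const, measure_univ, one_mul] at this
  rw [← lintegral_mul_const _ (by fun_prop), ← this]

/-- Kolmogorov's backward equation, in integral form. -/
lemma backward_equation (h : FirstEventDecomposition Pr J q X ζ σ θ G) (x : E)
    {φ : E → ENNReal} (hφ : Measurable φ) {t : ℝ} (ht : 0 ≤ t) :
    ∫⁻ ω, φ (X t ω) ∂Pr x = ENNReal.ofReal (Real.exp (-(q x * t))) * φ x +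
      ∫⁻ v in Set.Ioc 0 t, ENNReal.ofReal (Real.exp (-(q x * (t - v)))) *
        ∫⁻ y, ∫⁻ ω, φ (X v ω) ∂Pr y ∂J x := by
  rw [h.lintegral_process x hφ ht, ← Set.Ioc_union_Ioi_eq_Ioi ht,
    lintegral_union measurableSet_Ioi (Set.Ioc_disjoint_Ioi le_rfl), add_comm]
  -- An event time beyond t leaves the process at x and gives the first term. For an event time r ≤
  -- t the remaining time is v = t - r, and reflecting the interval gives the second.
  congr 1
  · rw [lintegral_Ioi_shift]
    have h1 : ∀ r ∈ Set.Ioi (0 : ℝ), ENNReal.ofReal (Real.exp (-(q x * (t + r)))) *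
        (∫⁻ y, ∫⁻ ω, φ (stateAt X t (x, t + r, ω)) ∂Pr y ∂J x) =
        ENNReal.ofReal (Real.exp (-(q x * t))) * φ x *
          (ENNReal.ofReal (Real.exp (-(q x * r))) * J x Set.univ) := by
      intro r hr
      have : ∀ ω, stateAt X t (x, t + r, ω) = x := fun ω => if_pos (by simpa using hr)
      simp only [this, lintegral_const, measure_univ, mul_one]
      rw [mul_add, neg_add, Real.exp_add, ENNReal.ofReal_mul (by positivity)]
      ring
    rw [setLIntegral_congr_fun measurableSet_Ioi h1, lintegral_const_mul _ (by fun_prop),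
      lintegral_mul_const _ (by fun_prop), h.lintegral_law_one, mul_one]
  · refine Eq.trans ?_ (lintegral_Ioc_sub_left t fun v =>
      ENNReal.ofReal (Real.exp (-(q x * (t - v)))) * ∫⁻ y, ∫⁻ ω, φ (X v ω) ∂Pr y ∂J x)
    refine setLIntegral_congr_fun measurableSet_Ioc fun r hr => ?_
    have : ∀ ω, stateAt X t (x, r, ω) = X (t - r) ω := fun ω => if_neg (not_lt.2 hr.2)
    simp only [this, sub_sub_cancel]

/-- A finite measure `ρ` with `∫ q dρ < ∞` and `ρ (q - J) = 0` is invariant. -/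
lemma lintegral_process_invariant [IsSFiniteKernel J]
    (h : FirstEventDecomposition Pr J q X ζ σ θ G) (hqm : Measurable q) (hq : ∀ x, 0 ≤ q x)
    (ρ : Measure E) [SFinite ρ] (hfin : ∫⁻ x, ENNReal.ofReal (q x) ∂ρ ≠ ⊤)
    (hρ : ∀ g : E → ENNReal, Measurable g →
      ∫⁻ x, ∫⁻ y, g y ∂J x ∂ρ = ∫⁻ x, ENNReal.ofReal (q x) * g x ∂ρ)
    {A : Set E} (hA : MeasurableSet A) {t : ℝ} (ht : 0 ≤ t) :
    ∫⁻ x, Pr x (X t ⁻¹' A) ∂ρ = ρ A := by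
  have hφ : Measurable (A.indicator (1 : E → ENNReal)) := measurable_one.indicator hA
  set φ := A.indicator (1 : E → ENNReal) with hφd
  set u : ℝ → E → ENNReal := fun s x => ∫⁻ ω, φ (X s ω) ∂Pr x with hu
  have humeas : Measurable fun p : ℝ × E => u p.1 p.2 := by
    have : Measurable fun p : (ℝ × E) × Ω => φ (X p.1.1 p.2) :=
      hφ.comp (h.measurable_process.comp (f := fun p : (ℝ × E) × Ω => (p.1.1, p.2)) (by fun_prop))
    exact this.lintegral_kernel_prod_right' (κ := Pr.comap Prod.snd measurable_snd)
  have hu1 : ∀ s x, u s x ≤ 1 := by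
    intro s x
    calc u s x ≤ ∫⁻ _, 1 ∂Pr x :=
          lintegral_mono fun ω => Set.indicator_le_self' (fun _ _ => zero_le) _
      _ = 1 := by simp
  set w : ℝ → E → ENNReal := fun s x => ∫⁻ y, u s y ∂J x with hw
  have hwmeas : Measurable fun p : ℝ × E => w p.1 p.2 := by
    have : Measurable fun p : (ℝ × E) × E => u p.1.1 p.2 :=
      humeas.comp (f := fun p : (ℝ × E) × E => (p.1.1, p.2)) (by fun_prop)
    exact this.lintegral_kernel_prod_right' (κ := J.comap Prod.snd measurable_snd)
  -- The backward equation integrated in time; integrating it against ρ makes the balance hypothesis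
  -- applicable at each fixed s.
  have key : ∀ x, u t x + ENNReal.ofReal (q x) * ∫⁻ s in Set.Ioc 0 t, u s x =
      φ x + ∫⁻ s in Set.Ioc 0 t, w s x := fun x =>
    add_mul_lintegral_of_variation_of_constants (hq x) (φ x) (hwmeas.comp measurable_prodMk_right)
      (fun s hs => h.backward_equation x hφ hs) ht
  have humeas' : ∀ s, Measurable (u s) := fun s => humeas.comp measurable_prodMk_left
  have humeas'' : ∀ x, Measurable fun s => u s x := fun x => humeas.comp measurable_prodMk_right
  set c := ∫⁻ s in Set.Ioc 0 t, ∫⁻ x, ENNReal.ofReal (q x) * u s x ∂ρ with hc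
  -- Since u ≤ 1, the flux accumulated up to time t is at most t ∫ q dρ. This finiteness is what
  -- permits the cancellation at the end.
  have hcfin : c ≠ ⊤ := by
    refine ne_top_of_le_ne_top (b := (∫⁻ x, ENNReal.ofReal (q x) ∂ρ) * ENNReal.ofReal t)
      (ENNReal.mul_ne_top hfin ENNReal.ofReal_ne_top) ?_
    calc c ≤ ∫⁻ s in Set.Ioc 0 t, ∫⁻ x, ENNReal.ofReal (q x) ∂ρ :=
          lintegral_mono fun s => lintegral_mono fun x => mul_le_of_le_one_right' (hu1 s x)
      _ = _ := by simp
  have e1 : ∫⁻ x, (u t x + ENNReal.ofReal (q x) * ∫⁻ s in Set.Ioc 0 t, u s x) ∂ρ =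
      ∫⁻ x, u t x ∂ρ + c := by
    rw [lintegral_add_left (humeas' t), hc, lintegral_lintegral_swap]
    · congr 1
      refine lintegral_congr fun x => ?_
      rw [lintegral_const_mul _ (humeas'' x)]
    · exact ((hqm.ennreal_ofReal.comp measurable_snd).mul humeas).aemeasurable
  have e2 : ∫⁻ x, (φ x + ∫⁻ s in Set.Ioc 0 t, w s x) ∂ρ = ρ A + c := by
    rw [lintegral_add_left hφ, hφd, lintegral_indicator_one hA, hc, lintegral_lintegral_swap]
    · congr 1
      refine lintegral_congr fun s => ?_
      exact hρ _ (humeas' s)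
    · exact (hwmeas.comp measurable_swap).aemeasurable
  have e3 : ∫⁻ x, u t x ∂ρ + c = ρ A + c := by
    rw [← e1, ← e2]
    exact lintegral_congr key
  rw [← (ENNReal.add_left_inj hcfin).1 e3]
  refine lintegral_congr fun x => ?_
  rw [← lintegral_indicator_one (h.measurable_process_at t hA)]
  rfl

end FirstEventDecomposition
end FirstEvent

/-! ### Pathwise analysis of jumps, lifetimes and regenerations -/

section Paths

variable {E : Type*} {rate κ : E → ℝ}

/-- The driving randomness after the first jump. -/
def jumpShift (ω : JumpSample E) : JumpSample E :=
  (fun n => ω.1 (n + 1), fun n => ω.2 (n + 1))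

lemma jumpTime_one (ω : JumpSample E) : jumpTime rate ω 1 = ω.2 0 / rate (ω.1 0) := by
  simp [jumpTime]

lemma jumpTime_succ (ω : JumpSample E) (n : ℕ) :
    jumpTime rate ω (n + 1) = jumpTime rate ω 1 + jumpTime rate (jumpShift ω) n := by
  simp [jumpTime, Finset.sum_range_succ', jumpShift, add_comm]

lemma tendsto_jumpTime_jumpShift {ω : JumpSample E}
    (h : Filter.Tendsto (jumpTime rate ω) Filter.atTop Filter.atTop) :
    Filter.Tendsto (jumpTime rate (jumpShift ω)) Filter.atTop Filter.atTop := by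
  have h1 : jumpTime rate (jumpShift ω) =
      fun n => -jumpTime rate ω 1 + jumpTime rate ω (n + 1) := by
    ext n
    rw [jumpTime_succ ω n]
    ring
  rw [h1]
  exact Filter.tendsto_atTop_add_const_left _ _ (h.comp (Filter.tendsto_add_atTop_nat 1))

/-- Nonemptiness matters: in ℕ the infimum of the empty set is 0. It is supplied below by the
divergence of the jump or regeneration times. -/
lemma sInf_eq_sInf_succ_mem_add_one {S : Set ℕ} (h0 : 0 ∉ S) (hne : S.Nonempty) :
    sInf S = sInf {n | n + 1 ∈ S} + 1 := by
  have h1 : 1 ≤ sInf {n | n ∈ S} := by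
    rw [Nat.one_le_iff_ne_zero]
    intro h
    rcases Nat.sInf_eq_zero.1 h with h | h
    · exact h0 h
    · exact hne.ne_empty h
  exact (Nat.sInf_add (p := fun n => n ∈ S) h1).symm

lemma jumpProcess_of_lt {ω : JumpSample E} {t : ℝ} (ht : t < jumpTime rate ω 1) :
    jumpProcess rate ω t = ω.1 0 := by
  have h0 : 0 ∈ {n : ℕ | t < jumpTime rate ω (n + 1)} := ht
  rw [jumpProcess, Nat.sInf_eq_zero.2 (Or.inl h0)]

lemma jumpProcess_add {ω : JumpSample E}
    (h : Filter.Tendsto (jumpTime rate ω) Filter.atTop Filter.atTop) {t : ℝ} (ht : 0 ≤ t) :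
    jumpProcess rate ω (jumpTime rate ω 1 + t) = jumpProcess rate (jumpShift ω) t := by
  unfold jumpProcess
  set S := {n : ℕ | jumpTime rate ω 1 + t < jumpTime rate ω (n + 1)} with hS
  have h0 : 0 ∉ S := by simp [hS, ht]
  have hne : S.Nonempty := by
    obtain ⟨n, hn⟩ := ((h.comp (Filter.tendsto_add_atTop_nat 1)).eventually_gt_atTop
      (jumpTime rate ω 1 + t)).exists
    exact ⟨n, hn⟩
  have h2 : {n : ℕ | n + 1 ∈ S} = {n : ℕ | t < jumpTime rate (jumpShift ω) (n + 1)} := by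
    ext n
    simp only [hS, Set.mem_ofPred_eq]
    rw [jumpTime_succ ω (n + 1), add_lt_add_iff_left]
  rw [sInf_eq_sInf_succ_mem_add_one h0 hne, h2]
  rfl

/-- The hazard accumulated by the jump process up to time `t`. -/
noncomputable def hazard (rate κ : E → ℝ) (ω : JumpSample E) (t : ℝ) : ENNReal :=
  ∫⁻ s in Set.Ioc 0 t, ENNReal.ofReal (κ (jumpProcess rate ω s))

lemma hazard_of_le {ω : JumpSample E} (hκ : ∀ x, 0 ≤ κ x) {t : ℝ} (ht : t ≤ jumpTime rate ω 1) :
    hazard rate κ ω t = ENNReal.ofReal (κ (ω.1 0) * t) := by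
  unfold hazard
  -- The right endpoint is discarded because at the jump time the process is no longer in its first
  -- state.
  rw [setLIntegral_congr Ioo_ae_eq_Ioc.symm, setLIntegral_congr_fun
    (g := fun _ => ENNReal.ofReal (κ (ω.1 0))) measurableSet_Ioo
    fun s hs => by rw [jumpProcess_of_lt (hs.2.trans_le ht)]]
  simp [ENNReal.ofReal_mul (hκ _)]

lemma hazard_add {ω : JumpSample E} (hκ : ∀ x, 0 ≤ κ x)
    (h : Filter.Tendsto (jumpTime rate ω) Filter.atTop Filter.atTop)
    (h0 : 0 ≤ jumpTime rate ω 1) {t : ℝ} (ht : 0 ≤ t) :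
    hazard rate κ ω (jumpTime rate ω 1 + t) =
      ENNReal.ofReal (κ (ω.1 0) * jumpTime rate ω 1) + hazard rate κ (jumpShift ω) t := by
  rw [← hazard_of_le hκ le_rfl]
  unfold hazard
  rw [← Set.Ioc_union_Ioc_eq_Ioc h0 (le_add_of_nonneg_right ht),
    lintegral_union measurableSet_Ioc (Set.Ioc_disjoint_Ioc_of_le le_rfl)]
  congr 1
  have hp : MeasurePreserving (fun r : ℝ => jumpTime rate ω 1 + r) :=
    measurePreserving_add_left volume _
  rw [← hp.setLIntegral_comp_preimage_emb (measurableEmbedding_addLeft _)]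
  have : (fun r : ℝ => jumpTime rate ω 1 + r) ⁻¹'
      Set.Ioc (jumpTime rate ω 1) (jumpTime rate ω 1 + t) = Set.Ioc 0 t := by
    ext r
    simp
  rw [this]
  exact setLIntegral_congr_fun measurableSet_Ioc fun s hs => by rw [jumpProcess_add h hs.1.le]

/-- Up to the first jump the hazard grows linearly at rate κ(Z₀). If it has not consumed ξ by then,
the lifetime continues on the shifted path with the unconsumed part of ξ as its threshold. -/
lemma lifetime_eq_add {l : Life E} (hκ : ∀ x, 0 ≤ κ x)
    (h : Filter.Tendsto (jumpTime rate l.1) Filter.atTop Filter.atTop)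
    (h0 : 0 ≤ jumpTime rate l.1 1) (hl : κ (l.1.1 0) * jumpTime rate l.1 1 < l.2) :
    lifetime rate κ l = ENNReal.ofReal (jumpTime rate l.1 1) +
      lifetime rate κ (jumpShift l.1, l.2 - κ (l.1.1 0) * jumpTime rate l.1 1) := by
  have hc : 0 ≤ κ (l.1.1 0) * jumpTime rate l.1 1 := mul_nonneg (hκ _) h0
  have key : ∀ t, 0 ≤ t → (ENNReal.ofReal l.2 ≤ hazard rate κ l.1 (jumpTime rate l.1 1 + t) ↔
      ENNReal.ofReal (l.2 - κ (l.1.1 0) * jumpTime rate l.1 1) ≤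
        hazard rate κ (jumpShift l.1) t) := by
    intro t ht
    rw [hazard_add hκ h h0 ht, ENNReal.ofReal_sub _ hc, tsub_le_iff_left]
  unfold lifetime
  apply le_antisymm
  · rw [ENNReal.add_sInf]
    refine le_iInf₂ fun b hb => ?_
    obtain ⟨t, ⟨ht, htl⟩, rfl⟩ := hb
    rw [← ENNReal.ofReal_add h0 ht]
    exact sInf_le ⟨_, ⟨add_nonneg h0 ht, (key t ht).2 htl⟩, rfl⟩
  · refine le_sInf ?_
    rintro _ ⟨t, ⟨ht, htl⟩, rfl⟩
    -- Before the first jump the hazard is κ(Z₀) t, which is still below ξ, so every admissible time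
    -- lies after that jump.
    have htJ : jumpTime rate l.1 1 ≤ t := by
      by_contra! hlt
      change _ ≤ hazard rate κ l.1 t at htl
      rw [hazard_of_le hκ hlt.le, ENNReal.ofReal_le_ofReal_iff (mul_nonneg (hκ _) ht)] at htl
      have := mul_le_mul_of_nonneg_left hlt.le (hκ (l.1.1 0))
      linarith
    obtain ⟨s, rfl⟩ : ∃ s, t = jumpTime rate l.1 1 + s := ⟨t - jumpTime rate l.1 1, by ring⟩
    have hs : 0 ≤ s := by linarith
    rw [ENNReal.ofReal_add h0 hs]
    gcongr
    exact sInf_le ⟨_, ⟨hs, (key s hs).1 htl⟩, rfl⟩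

/-- The linear hazard κ(Z₀) t reaches ξ no later than the first jump, at time ξ / κ(Z₀). -/
lemma lifetime_eq_div {l : Life E} (hκ : ∀ x, 0 ≤ κ x) (h1 : 0 < l.2)
    (h2 : 0 < κ (l.1.1 0)) (hl : l.2 ≤ κ (l.1.1 0) * jumpTime rate l.1 1) :
    lifetime rate κ l = ENNReal.ofReal (l.2 / κ (l.1.1 0)) := by
  have hle : l.2 / κ (l.1.1 0) ≤ jumpTime rate l.1 1 := by
    rwa [div_le_iff₀' h2]
  apply le_antisymm
  · refine sInf_le ⟨_, ⟨by positivity, ?_⟩, rfl⟩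
    change _ ≤ hazard rate κ l.1 _
    rw [hazard_of_le hκ hle, mul_div_cancel₀ _ h2.ne']
  · refine le_sInf ?_
    rintro _ ⟨t, ⟨ht, htl⟩, rfl⟩
    refine ENNReal.ofReal_le_ofReal ?_
    by_contra! hlt
    change _ ≤ hazard rate κ l.1 t at htl
    rw [hazard_of_le hκ (hlt.le.trans hle),
      ENNReal.ofReal_le_ofReal_iff (mul_nonneg (hκ _) ht)] at htl
    rw [lt_div_iff₀' h2] at hlt
    linarith

/-- The tours that remain after the first regeneration. -/
def regenShift (ω : Sample E) : Sample E := (ω.2 0, fun i => ω.2 (i + 1))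

/-- The sample after the first jump, if this takes place before the first regeneration. -/
noncomputable def firstTourShift (rate κ : E → ℝ) (ω : Sample E) : Sample E :=
  ((jumpShift ω.1.1, ω.1.2 - κ (ω.1.1.1 0) * jumpTime rate ω.1.1 1), ω.2)

open Classical in
/-- The time of the first event: a jump of the interarrival process or a regeneration. -/
noncomputable def firstEvent (rate κ : E → ℝ) (ω : Sample E) : ℝ :=
  if κ (ω.1.1.1 0) * jumpTime rate ω.1.1 1 < ω.1.2 then jumpTime rate ω.1.1 1
  else ω.1.2 / κ (ω.1.1.1 0)

open Classical in
/-- The sample after the first event. -/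
noncomputable def eventShift (rate κ : E → ℝ) (ω : Sample E) : Sample E :=
  if κ (ω.1.1.1 0) * jumpTime rate ω.1.1 1 < ω.1.2 then firstTourShift rate κ ω
  else regenShift ω

/-- A tour with positive clocks and without explosion. -/
structure IsRegularLife (rate : E → ℝ) (l : Life E) : Prop where
  clock_pos : ∀ n, 0 < l.1.2 n
  tendsto : Filter.Tendsto (jumpTime rate l.1) Filter.atTop Filter.atTop
  lifetime_clock_pos : 0 < l.2

/-- A sample all of whose tours are regular, and whose regeneration times tend to infinity. -/
structure IsRegularSample (rate κ : E → ℝ) (ω : Sample E) : Prop where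
  tour : ∀ i, IsRegularLife rate (tour ω i)
  tendsto : Filter.Tendsto (regenTime rate κ ω) Filter.atTop (nhds ⊤)

lemma tour_regenShift (ω : Sample E) (i : ℕ) : tour (regenShift ω) i = tour ω (i + 1) := by
  cases i <;> rfl

lemma tour_firstTourShift_succ (ω : Sample E) (i : ℕ) :
    tour (firstTourShift rate κ ω) (i + 1) = tour ω (i + 1) := rfl

lemma regenTime_succ (ω : Sample E) (n : ℕ) :
    regenTime rate κ ω (n + 1) = lifetime rate κ ω.1 + regenTime rate κ (regenShift ω) n := by
  simp only [regenTime, Finset.sum_range_succ', tour_regenShift]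
  exact add_comm _ _

@[simp] lemma regenTime_zero (ω : Sample E) : regenTime rate κ ω 0 = 0 := by simp [regenTime]

lemma regenTime_one (ω : Sample E) : regenTime rate κ ω 1 = lifetime rate κ ω.1 := by
  simp [regenTime, tour]

lemma IsRegularLife.jumpTime_one_pos {l : Life E} (h : IsRegularLife rate l)
    (hrate : ∀ x, 0 < rate x) : 0 < jumpTime rate l.1 1 := by
  rw [jumpTime_one]
  exact div_pos (h.clock_pos 0) (hrate _)

lemma IsRegularLife.jumpShift {l : Life E} (h : IsRegularLife rate l) {c : ℝ} (hc : c < l.2) :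
    IsRegularLife rate (jumpShift l.1, l.2 - c) :=
  ⟨fun n => h.clock_pos (n + 1), tendsto_jumpTime_jumpShift h.tendsto, sub_pos.2 hc⟩

/-- With κ(Z₀) = 0 the hazard would be 0 at the first jump, still below ξ. Thus the quotient in
`firstEvent` is a genuine one when a regeneration comes first. -/
lemma IsRegularLife.rate_pos {l : Life E} (h : IsRegularLife rate l) (hκ : ∀ x, 0 ≤ κ x)
    (hl : ¬ κ (l.1.1 0) * jumpTime rate l.1 1 < l.2) : 0 < κ (l.1.1 0) := by
  refine (hκ _).lt_of_ne fun h0 => hl ?_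
  rw [← h0, zero_mul]
  exact h.lifetime_clock_pos

namespace IsRegularSample

variable {ω : Sample E}

lemma lifetime_of_jump (h : IsRegularSample rate κ ω) (hrate : ∀ x, 0 < rate x)
    (hκ : ∀ x, 0 ≤ κ x) (hl : κ (ω.1.1.1 0) * jumpTime rate ω.1.1 1 < ω.1.2) :
    lifetime rate κ ω.1 = ENNReal.ofReal (jumpTime rate ω.1.1 1) +
      lifetime rate κ (firstTourShift rate κ ω).1 :=
  lifetime_eq_add hκ (h.tour 0).tendsto ((h.tour 0).jumpTime_one_pos hrate).le hl

lemma regenTime_of_jump (h : IsRegularSample rate κ ω) (hrate : ∀ x, 0 < rate x)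
    (hκ : ∀ x, 0 ≤ κ x) (hl : κ (ω.1.1.1 0) * jumpTime rate ω.1.1 1 < ω.1.2) (n : ℕ) :
    regenTime rate κ ω (n + 1) = ENNReal.ofReal (jumpTime rate ω.1.1 1) +
      regenTime rate κ (firstTourShift rate κ ω) (n + 1) := by
  rw [regenTime_succ, regenTime_succ, h.lifetime_of_jump hrate hκ hl, add_assoc]
  rfl

lemma lifetime_of_regen (h : IsRegularSample rate κ ω)
    (hκ : ∀ x, 0 ≤ κ x) (hl : ¬ κ (ω.1.1.1 0) * jumpTime rate ω.1.1 1 < ω.1.2) :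
    lifetime rate κ ω.1 = ENNReal.ofReal (ω.1.2 / κ (ω.1.1.1 0)) :=
  lifetime_eq_div hκ (h.tour 0).lifetime_clock_pos ((h.tour 0).rate_pos hκ hl) (not_lt.1 hl)

lemma firstEvent_pos (h : IsRegularSample rate κ ω) (hrate : ∀ x, 0 < rate x)
    (hκ : ∀ x, 0 ≤ κ x) : 0 < firstEvent rate κ ω := by
  unfold firstEvent
  split_ifs with hl
  · exact (h.tour 0).jumpTime_one_pos hrate
  · exact div_pos (h.tour 0).lifetime_clock_pos ((h.tour 0).rate_pos hκ hl)

lemma firstEvent_le_jumpTime (h : IsRegularSample rate κ ω) (hκ : ∀ x, 0 ≤ κ x) :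
    firstEvent rate κ ω ≤ jumpTime rate ω.1.1 1 := by
  unfold firstEvent
  split_ifs with hl
  · rfl
  · have hpos : 0 < κ (ω.1.1.1 0) := (h.tour 0).rate_pos hκ hl
    rw [div_le_iff₀' hpos]
    exact not_lt.1 hl

lemma firstEvent_le_lifetime (h : IsRegularSample rate κ ω) (hrate : ∀ x, 0 < rate x)
    (hκ : ∀ x, 0 ≤ κ x) : ENNReal.ofReal (firstEvent rate κ ω) ≤ lifetime rate κ ω.1 := by
  unfold firstEvent
  split_ifs with hl
  · rw [h.lifetime_of_jump hrate hκ hl]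
    exact le_self_add
  · rw [h.lifetime_of_regen hκ hl]

lemma tendsto_of_eq_add {u v : ℕ → ENNReal} {c : ENNReal} (hc : c ≠ ⊤)
    (h : Filter.Tendsto u Filter.atTop (nhds ⊤)) (huv : ∀ᶠ n in Filter.atTop, u n = c + v n) :
    Filter.Tendsto v Filter.atTop (nhds ⊤) := by
  have h1 : Filter.Tendsto (fun n => u n - c) Filter.atTop (nhds (⊤ - c)) :=
    ENNReal.Tendsto.sub h tendsto_const_nhds (Or.inr hc)
  rw [ENNReal.top_sub hc] at h1
  refine h1.congr' ?_
  filter_upwards [huv] with n hn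
  rw [hn, ENNReal.add_sub_cancel_left hc]

lemma eventShift (h : IsRegularSample rate κ ω) (hrate : ∀ x, 0 < rate x)
    (hκ : ∀ x, 0 ≤ κ x) : IsRegularSample rate κ (eventShift rate κ ω) := by
  unfold Restore.eventShift
  split_ifs with hl
  · refine ⟨fun i => ?_, ?_⟩
    · cases i with
      | zero => exact (h.tour 0).jumpShift hl
      | succ i => exact h.tour (i + 1)
    · refine tendsto_of_eq_add (c := ENNReal.ofReal (jumpTime rate ω.1.1 1))
        ENNReal.ofReal_ne_top h.tendsto ?_
      filter_upwards [Filter.eventually_ge_atTop 1] with n hn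
      obtain ⟨n, rfl⟩ := Nat.exists_eq_add_of_le' hn
      exact h.regenTime_of_jump hrate hκ hl n
  · refine ⟨fun i => ?_, ?_⟩
    · rw [tour_regenShift]
      exact h.tour (i + 1)
    · refine tendsto_of_eq_add (c := ENNReal.ofReal (ω.1.2 / κ (ω.1.1.1 0)))
        ENNReal.ofReal_ne_top (h.tendsto.comp (Filter.tendsto_add_atTop_nat 1)) ?_
      refine Filter.Eventually.of_forall fun n => ?_
      simp only [Function.comp]
      rw [regenTime_succ, h.lifetime_of_regen hκ hl]

lemma restoreProcess_of_lt (h : IsRegularSample rate κ ω) (hrate : ∀ x, 0 < rate x)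
    (hκ : ∀ x, 0 ≤ κ x) {t : ℝ} (ht : t < firstEvent rate κ ω) :
    restoreProcess rate κ t ω = ω.1.1.1 0 := by
  have h1 : tourIndex rate κ ω t = 0 := by
    refine Nat.sInf_eq_zero.2 (Or.inl ?_)
    simp only [Set.mem_ofPred_eq, zero_add, regenTime_one]
    refine lt_of_lt_of_le ?_ (h.firstEvent_le_lifetime hrate hκ)
    exact (ENNReal.ofReal_lt_ofReal_iff (h.firstEvent_pos hrate hκ)).2 ht
  unfold restoreProcess
  rw [h1, regenTime_zero, ENNReal.toReal_zero, sub_zero]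
  exact jumpProcess_of_lt (ht.trans_le (h.firstEvent_le_jumpTime hκ))

lemma exists_lt_regenTime (h : IsRegularSample rate κ ω) (t : ℝ) :
    ∃ i, ENNReal.ofReal t < regenTime rate κ ω (i + 1) :=
  ((h.tendsto.comp (Filter.tendsto_add_atTop_nat 1)).eventually
    (lt_mem_nhds ENNReal.ofReal_lt_top)).exists

/-- If a jump comes first, the index of the current tour is unchanged and only the first tour is
shifted. If a regeneration comes first, that tour is dropped and the index falls by one. -/
lemma restoreProcess_add (h : IsRegularSample rate κ ω) (hrate : ∀ x, 0 < rate x)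
    (hκ : ∀ x, 0 ≤ κ x) {t : ℝ} (ht : 0 ≤ t) :
    restoreProcess rate κ (firstEvent rate κ ω + t) ω =
      restoreProcess rate κ t (Restore.eventShift rate κ ω) := by
  have hpos := h.firstEvent_pos hrate hκ
  have hreg := h.eventShift hrate hκ
  unfold firstEvent Restore.eventShift at *
  split_ifs at * with hl
  · set J := jumpTime rate ω.1.1 1 with hJ
    have h1 : tourIndex rate κ ω (J + t) = tourIndex rate κ (firstTourShift rate κ ω) t := by
      unfold tourIndex
      congr 1
      ext i
      simp only [Set.mem_ofPred_eq]
      rw [h.regenTime_of_jump hrate hκ hl, ENNReal.ofReal_add hpos.le ht,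
        ENNReal.add_lt_add_iff_left ENNReal.ofReal_ne_top]
    unfold restoreProcess
    rw [h1]
    rcases hi : tourIndex rate κ (firstTourShift rate κ ω) t with _ | i
    · simp only [regenTime_zero, ENNReal.toReal_zero, sub_zero]
      exact jumpProcess_add (h.tour 0).tendsto ht
    -- By minimality of the tour index this regeneration time is at most t, hence finite, and
    -- `toReal` is additive here.
    · have hfin : regenTime rate κ (firstTourShift rate κ ω) (i + 1) ≠ ⊤ := by
        have : i ∉ {i : ℕ | ENNReal.ofReal t <
            regenTime rate κ (firstTourShift rate κ ω) (i + 1)} :=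
          Nat.notMem_of_lt_sInf (by rw [tourIndex] at hi; omega)
        exact ne_top_of_le_ne_top ENNReal.ofReal_ne_top (not_lt.1 this)
      rw [h.regenTime_of_jump hrate hκ hl, tour_firstTourShift_succ,
        ENNReal.toReal_add ENNReal.ofReal_ne_top hfin, ENNReal.toReal_ofReal hpos.le]
      congr 1
      ring
  · set J := ω.1.2 / κ (ω.1.1.1 0) with hJ
    have hL := h.lifetime_of_regen hκ hl
    set S := {i : ℕ | ENNReal.ofReal (J + t) < regenTime rate κ ω (i + 1)} with hS
    have h0 : 0 ∉ S := by
      simp only [hS, Set.mem_ofPred_eq, zero_add, regenTime_one, hL, not_lt]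
      exact ENNReal.ofReal_le_ofReal (by linarith)
    have h2 : {i : ℕ | i + 1 ∈ S} =
        {i : ℕ | ENNReal.ofReal t < regenTime rate κ (regenShift ω) (i + 1)} := by
      ext i
      simp only [hS, Set.mem_ofPred_eq]
      rw [regenTime_succ ω (i + 1), hL, ENNReal.ofReal_add hpos.le ht,
        ENNReal.add_lt_add_iff_left ENNReal.ofReal_ne_top]
    have h3 : tourIndex rate κ ω (J + t) = tourIndex rate κ (regenShift ω) t + 1 := by
      have h4 := sInf_eq_sInf_succ_mem_add_one h0 (h.exists_lt_regenTime (J + t))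
      rwa [h2] at h4
    have hfin : regenTime rate κ (regenShift ω) (tourIndex rate κ (regenShift ω) t) ≠ ⊤ := by
      rcases hi : tourIndex rate κ (regenShift ω) t with _ | i
      · simp
      · have : i ∉ {i : ℕ | ENNReal.ofReal t < regenTime rate κ (regenShift ω) (i + 1)} :=
          Nat.notMem_of_lt_sInf (by rw [tourIndex] at hi; omega)
        exact ne_top_of_le_ne_top ENNReal.ofReal_ne_top (not_lt.1 this)
    unfold restoreProcess
    rw [h3, regenTime_succ, hL, tour_regenShift, ENNReal.toReal_add ENNReal.ofReal_ne_top hfin,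
      ENNReal.toReal_ofReal hpos.le]
    congr 1
    ring

/-- Double induction on a bound m for the number of regenerations and a bound k for the number of
jumps in the current tour. A jump lowers k and keeps m; a regeneration lowers m, and nonexplosion of
the new tour supplies a fresh k. -/
lemma exists_lt_eventTime_aux (hrate : ∀ x, 0 < rate x) (hκ : ∀ x, 0 ≤ κ x) (m : ℕ) :
    ∀ k (ω : Sample E), IsRegularSample rate κ ω → ∀ M,
      ENNReal.ofReal M < regenTime rate κ ω m → M < jumpTime rate ω.1.1 k →
        ∃ n, M < eventTime (firstEvent rate κ) (Restore.eventShift rate κ) n ω := by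
  induction m with
  | zero =>
    intro k ω _ M hM
    simp at hM
  | succ m ihm =>
    intro k
    induction k with
    | zero =>
      intro ω _ M _ hM
      exact ⟨0, by simpa [jumpTime] using hM⟩
    | succ k ihk =>
      intro ω h M hM hMk
      suffices ∃ n, M - firstEvent rate κ ω < eventTime (firstEvent rate κ)
          (Restore.eventShift rate κ) n (Restore.eventShift rate κ ω) by
        obtain ⟨n, hn⟩ := this
        exact ⟨n + 1, by rw [eventTime_succ]; linarith⟩
      have hpos := h.firstEvent_pos hrate hκ
      have hreg := h.eventShift hrate hκ
      rcases lt_or_ge M (firstEvent rate κ ω) with hlt | hge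
      · exact ⟨0, by simpa using hlt⟩
      obtain ⟨N, rfl⟩ : ∃ N, M = firstEvent rate κ ω + N := ⟨M - firstEvent rate κ ω, by ring⟩
      have hN : 0 ≤ N := by linarith
      rw [add_sub_cancel_left]
      rw [ENNReal.ofReal_add hpos.le hN] at hM
      by_cases hl : κ (ω.1.1.1 0) * jumpTime rate ω.1.1 1 < ω.1.2
      · have e1 : firstEvent rate κ ω = jumpTime rate ω.1.1 1 := if_pos hl
        have e2 : Restore.eventShift rate κ ω = firstTourShift rate κ ω := if_pos hl
        refine ihk _ hreg N ?_ ?_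
        · rw [h.regenTime_of_jump hrate hκ hl, e1,
            ENNReal.add_lt_add_iff_left ENNReal.ofReal_ne_top] at hM
          rwa [e2]
        · rw [jumpTime_succ, e1, add_lt_add_iff_left] at hMk
          rw [e2]
          exact hMk
      · have e1 : firstEvent rate κ ω = ω.1.2 / κ (ω.1.1.1 0) := if_neg hl
        have e2 : Restore.eventShift rate κ ω = regenShift ω := if_neg hl
        obtain ⟨k', hk'⟩ := ((hreg.tour 0).tendsto.eventually_gt_atTop N).exists
        refine ihm k' _ hreg N ?_ hk'
        rw [regenTime_succ, h.lifetime_of_regen hκ hl, e1,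
          ENNReal.add_lt_add_iff_left ENNReal.ofReal_ne_top] at hM
        rwa [e2]

lemma exists_lt_eventTime (h : IsRegularSample rate κ ω) (hrate : ∀ x, 0 < rate x)
    (hκ : ∀ x, 0 ≤ κ x) (M : ℝ) :
    ∃ n, M < eventTime (firstEvent rate κ) (Restore.eventShift rate κ) n ω := by
  obtain ⟨i, hi⟩ := h.exists_lt_regenTime M
  obtain ⟨k, hk⟩ := ((h.tour 0).tendsto.eventually_gt_atTop M).exists
  exact exists_lt_eventTime_aux hrate hκ (i + 1) k ω h M hi hk

end IsRegularSample
end Paths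

/-! ### Measurability of the construction -/

section Measurability

lemma measurable_sInf_setOf {α : Type*} [MeasurableSpace α] {p : ℕ → α → Prop}
    (hp : ∀ n, MeasurableSet {a | p n a}) : Measurable fun a => sInf {n | p n a} := by
  refine measurable_to_countable' fun k => ?_
  -- The second set accounts for the default value: the infimum is also 0 when no index satisfies p.
  have h : (fun a => sInf {n | p n a}) ⁻¹' {k} =
      ({a | p k a} ∩ ⋂ m ∈ Finset.range k, {a | p m a}ᶜ) ∪
        (if k = 0 then ⋂ n, {a | p n a}ᶜ else ∅) := by
    ext a
    simp only [Set.mem_preimage, Set.mem_singleton_iff, Set.mem_union, Set.mem_inter_iff,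
      Set.mem_iInter, Set.mem_compl_iff, Set.mem_ofPred_eq, Finset.mem_range]
    constructor
    · rintro rfl
      by_cases hne : {n | p n a}.Nonempty
      · exact Or.inl ⟨Nat.sInf_mem hne, fun m hm => Nat.notMem_of_lt_sInf hm⟩
      · rw [Set.not_nonempty_iff_eq_empty] at hne
        right
        rw [hne, Nat.sInf_empty, if_pos rfl]
        simp only [Set.mem_iInter, Set.mem_compl_iff, Set.mem_ofPred_eq]
        intro n hn
        have : n ∈ {n | p n a} := hn
        simp [hne] at this
    · rintro (⟨h1, h2⟩ | h)
      · refine le_antisymm (Nat.sInf_le h1) (le_csInf ⟨k, h1⟩ fun m hm => ?_)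
        by_contra! hlt
        exact h2 m hlt hm
      · split_ifs at h with hk
        · rw [hk, Nat.sInf_eq_zero]
          right
          ext n
          simpa using Set.mem_iInter.1 h n
        · exact absurd h (Set.notMem_empty _)
  rw [h]
  refine MeasurableSet.union ((hp k).inter
    (Finset.measurableSet_biInter _ fun m _ => (hp m).compl)) ?_
  split_ifs
  · exact MeasurableSet.iInter fun n => (hp n).compl
  · exact .empty

/-- A measurable family indexed by `ℕ`, evaluated at a measurable index. -/
lemma measurable_eval_nat {α β : Type*} [MeasurableSpace α] [MeasurableSpace β]
    {f : ℕ → α → β} (hf : ∀ n, Measurable (f n)) {N : α → ℕ} (hN : Measurable N) :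
    Measurable fun a => f (N a) a := by
  have : Measurable fun p : ℕ × α => f p.1 p.2 := measurable_from_prod_countable_right hf
  exact this.comp (hN.prodMk measurable_id)

variable {E : Type*} [MeasurableSpace E] {rate κ : E → ℝ}

lemma measurable_jumpTime (hrate : Measurable rate) (n : ℕ) :
    Measurable fun ω : JumpSample E => jumpTime rate ω n := by
  unfold jumpTime
  fun_prop

lemma measurable_jumpProcess (hrate : Measurable rate) :
    Measurable fun p : ℝ × JumpSample E => jumpProcess rate p.2 p.1 := by
  unfold jumpProcess
  refine measurable_eval_nat (f := fun n (p : ℝ × JumpSample E) => p.2.1 n) (by fun_prop) ?_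
  refine measurable_sInf_setOf fun n => ?_
  exact measurableSet_lt measurable_fst ((measurable_jumpTime hrate (n + 1)).comp measurable_snd)

lemma measurable_hazard (hrate : Measurable rate) (hκ : Measurable κ) (t : ℝ) :
    Measurable fun ω : JumpSample E => hazard rate κ ω t := by
  have h : Measurable fun p : JumpSample E × ℝ => ENNReal.ofReal (κ (jumpProcess rate p.1 p.2)) :=
    (hκ.comp ((measurable_jumpProcess hrate).comp measurable_swap)).ennreal_ofReal
  exact h.lintegral_prod_right'

lemma hazard_mono (ω : JumpSample E) : Monotone (hazard rate κ ω) :=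
  fun _ _ h => lintegral_mono_set (Set.Ioc_subset_Ioc_right h)

/-- The hazard is monotone in time, so whether the lifetime is below a can be tested at rational
times only. -/
lemma measurable_lifetime (hrate : Measurable rate) (hκ : Measurable κ) :
    Measurable (lifetime rate κ : Life E → ENNReal) := by
  refine measurable_of_Iio fun a => ?_
  have h : lifetime rate κ ⁻¹' Set.Iio a =
      ⋃ q : {q : ℚ // 0 ≤ q ∧ ENNReal.ofReal q < a},
        {l : Life E | ENNReal.ofReal l.2 ≤ hazard rate κ l.1 q} := by
    ext l
    simp only [Set.mem_preimage, Set.mem_Iio, Set.mem_iUnion, Set.mem_ofPred_eq]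
    unfold lifetime
    rw [sInf_lt_iff]
    constructor
    · rintro ⟨_, ⟨t, ⟨ht, htl⟩, rfl⟩, hta⟩
      obtain ⟨q, hq0, hq1, hq2⟩ := ENNReal.lt_iff_exists_rat_btwn.1 hta
      refine ⟨⟨q, hq0, hq2⟩, htl.trans (hazard_mono _ ?_)⟩
      exact (ENNReal.ofReal_le_ofReal_iff (by exact_mod_cast hq0)).1 hq1.le
    · rintro ⟨⟨q, hq0, hqa⟩, hq⟩
      exact ⟨_, ⟨q, ⟨by exact_mod_cast hq0, hq⟩, rfl⟩, hqa⟩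
  rw [h]
  refine MeasurableSet.iUnion fun q => ?_
  exact measurableSet_le (by fun_prop) ((measurable_hazard hrate hκ _).comp measurable_fst)

lemma measurable_tour (i : ℕ) : Measurable fun ω : Sample E => tour ω i := by
  cases i with
  | zero => exact measurable_fst
  | succ i => exact (measurable_pi_apply i).comp measurable_snd

lemma measurable_regenTime (hrate : Measurable rate) (hκ : Measurable κ) (n : ℕ) :
    Measurable fun ω : Sample E => regenTime rate κ ω n :=
  Finset.measurable_sum _ fun i _ => (measurable_lifetime hrate hκ).comp (measurable_tour i)

lemma measurable_restoreProcess (hrate : Measurable rate) (hκ : Measurable κ) :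
    Measurable fun p : ℝ × Sample E => restoreProcess rate κ p.1 p.2 := by
  have hN : Measurable fun p : ℝ × Sample E => tourIndex rate κ p.2 p.1 :=
    measurable_sInf_setOf fun n => measurableSet_lt measurable_fst.ennreal_ofReal
      ((measurable_regenTime hrate hκ (n + 1)).comp measurable_snd)
  refine measurable_eval_nat (f := fun n (p : ℝ × Sample E) =>
    jumpProcess rate (tour p.2 n).1 (p.1 - (regenTime rate κ p.2 n).toReal)) (fun n => ?_) hN
  have h1 : Measurable fun p : ℝ × Sample E => p.1 - (regenTime rate κ p.2 n).toReal :=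
    measurable_fst.sub ((measurable_regenTime hrate hκ n).comp measurable_snd).ennreal_toReal
  have h2 : Measurable fun p : ℝ × Sample E => (tour p.2 n).1 :=
    measurable_fst.comp ((measurable_tour n).comp measurable_snd)
  exact (measurable_jumpProcess hrate).comp (h1.prodMk h2)

lemma measurable_jumpTime_one_tour (hrate : Measurable rate) :
    Measurable fun ω : Sample E => jumpTime rate ω.1.1 1 :=
  (measurable_jumpTime hrate 1).comp (measurable_fst.comp measurable_fst)

lemma measurableSet_jump_first (hrate : Measurable rate) (hκ : Measurable κ) :
    MeasurableSet {ω : Sample E | κ (ω.1.1.1 0) * jumpTime rate ω.1.1 1 < ω.1.2} := by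
  have h := measurable_jumpTime_one_tour hrate
  exact measurableSet_lt (Measurable.mul (by fun_prop) h) (by fun_prop)

lemma measurable_firstEvent (hrate : Measurable rate) (hκ : Measurable κ) :
    Measurable (firstEvent rate κ : Sample E → ℝ) := by
  have h := measurable_jumpTime_one_tour hrate
  exact Measurable.ite (measurableSet_jump_first hrate hκ) h (by fun_prop)

lemma measurable_eventShift (hrate : Measurable rate) (hκ : Measurable κ) :
    Measurable (eventShift rate κ : Sample E → Sample E) := by
  have h := measurable_jumpTime_one_tour hrate
  refine Measurable.ite (measurableSet_jump_first hrate hκ) ?_ ?_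
  · unfold firstTourShift jumpShift
    have h1 : Measurable fun ω : Sample E => ω.1.2 - κ (ω.1.1.1 0) * jumpTime rate ω.1.1 1 :=
      Measurable.sub (by fun_prop) (Measurable.mul (by fun_prop) h)
    fun_prop
  · unfold regenShift
    fun_prop

lemma measurableSet_isRegularLife (hrate : Measurable rate) :
    MeasurableSet {l : Life E | IsRegularLife rate l} := by
  have h : {l : Life E | IsRegularLife rate l} = (⋂ n, {l : Life E | 0 < l.1.2 n}) ∩
      ({l : Life E | Filter.Tendsto (fun n => jumpTime rate l.1 n) Filter.atTop Filter.atTop} ∩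
        {l : Life E | 0 < l.2}) := by
    ext l
    simp only [Set.mem_inter_iff, Set.mem_iInter, Set.mem_ofPred_eq]
    exact ⟨fun h => ⟨h.1, h.2, h.3⟩, fun h => ⟨h.1, h.2.1, h.2.2⟩⟩
  rw [h]
  refine (MeasurableSet.iInter fun n => measurableSet_lt (by fun_prop) (by fun_prop)).inter
    (MeasurableSet.inter ?_ (measurableSet_lt (by fun_prop) (by fun_prop)))
  exact measurableSet_tendsto Filter.atTop fun n => (measurable_jumpTime hrate n).comp measurable_fst

end Measurability

/-! ### Almost every sample is regular -/

section AlmostSure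

lemma lintegral_expMeasure_one {f : ℝ → ENNReal} (hf : Measurable f) :
    ∫⁻ r, f r ∂expMeasure 1 =
      ∫⁻ r in Set.Ioi 0, ENNReal.ofReal (Real.exp (-r)) * f r := by
  have h : expMeasure 1 = volume.withDensity (exponentialPDF 1) := rfl
  have hm : Measurable (exponentialPDF 1) := (measurable_exponentialPDFReal 1).ennreal_ofReal
  rw [h, lintegral_withDensity_eq_lintegral_mul _ hm hf,
    setLIntegral_congr Ioi_ae_eq_Ici, ← lintegral_indicator measurableSet_Ici]
  refine lintegral_congr fun r => ?_
  by_cases hr : 0 ≤ r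
  · simp [hr, exponentialPDF_eq]
  · simp [hr, exponentialPDF_eq]

lemma ae_expMeasure_pos : ∀ᵐ ξ ∂expMeasure 1, 0 < ξ := by
  have hm : MeasurableSet {ξ : ℝ | ¬ 0 < ξ} :=
    (measurableSet_lt measurable_const measurable_id).compl
  rw [ae_iff, ← lintegral_indicator_one hm,
    lintegral_expMeasure_one (measurable_one.indicator hm), setLIntegral_congr_fun
    (g := fun _ => 0) measurableSet_Ioi fun r hr => ?_, lintegral_zero]
  rw [Set.indicator_of_notMem (by simpa using hr), mul_zero]

variable {E : Type*} [MeasurableSpace E] {rate κ : E → ℝ} {P : Kernel E E} [IsMarkovKernel P]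

lemma ae_isRegularLife (hne : Nonexplosive P rate) (x : E) :
    ∀ᵐ l ∂lifeKernel P x, IsRegularLife rate l := by
  have h1 : ∀ᵐ ω ∂jumpKernel P x, ∀ n, 0 < ω.2 n := by
    rw [jumpKernel, Kernel.prod_apply, Kernel.const_apply]
    refine Measure.quasiMeasurePreserving_snd.ae (p := fun e : ℕ → ℝ => ∀ n, 0 < e n) ?_
    rw [ae_all_iff]
    intro n
    exact (measurePreserving_eval_infinitePi (fun _ : ℕ => expMeasure 1)
      n).quasiMeasurePreserving.ae ae_expMeasure_pos
  rw [lifeKernel, Kernel.prod_apply, Kernel.const_apply]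
  filter_upwards [Measure.quasiMeasurePreserving_fst.ae h1,
    Measure.quasiMeasurePreserving_fst.ae (hne x),
    Measure.quasiMeasurePreserving_snd.ae ae_expMeasure_pos] with l h1 h2 h3
  exact ⟨h1, h2, h3⟩

lemma IsRegularLife.lifetime_pos {l : Life E} (h : IsRegularLife rate l)
    (hrate : ∀ x, 0 < rate x) (hκ : ∀ x, 0 ≤ κ x) : 0 < lifetime rate κ l := by
  have hJ := h.jumpTime_one_pos hrate
  by_cases hl : κ (l.1.1 0) * jumpTime rate l.1 1 < l.2
  · rw [lifetime_eq_add hκ h.tendsto hJ.le hl]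
    exact (ENNReal.ofReal_pos.2 hJ).trans_le le_self_add
  · have hpos := h.rate_pos hκ hl
    rw [lifetime_eq_div hκ h.lifetime_clock_pos hpos (not_lt.1 hl), ENNReal.ofReal_pos]
    exact div_pos h.lifetime_clock_pos hpos

/-- Independent copies of a random variable that is positive almost surely have an infinite
sum. -/
lemma ae_tsum_infinitePi_eq_top {α : Type*} [MeasurableSpace α] (ρ : Measure α)
    [IsProbabilityMeasure ρ] {f : α → ENNReal} (hf : Measurable f) (hpos : ∀ᵐ a ∂ρ, 0 < f a) :
    ∀ᵐ v ∂Measure.infinitePi (fun _ : ℕ => ρ), ∑' i, f (v i) = ⊤ := by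
  -- If no such ε existed, f would be almost surely below 1/n for every n, contradicting positivity.
  obtain ⟨ε, hε, hlt⟩ : ∃ ε : ENNReal, 0 < ε ∧ ρ {a | f a < ε} < 1 := by
    by_contra! hcon
    have h1 : ∀ n : ℕ, ∀ᵐ a ∂ρ, f a < (n : ENNReal)⁻¹ := by
      intro n
      have := le_antisymm prob_le_one (hcon (n : ENNReal)⁻¹ (by simp))
      exact (prob_compl_eq_zero_iff (measurableSet_lt hf measurable_const)).2 this
    obtain ⟨a, ha, ha'⟩ := ((ae_all_iff.2 h1).and hpos).exists
    obtain ⟨n, hn⟩ := ENNReal.exists_inv_nat_lt ha'.ne'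
    exact lt_asymm hn (ha n)
  have hS : MeasurableSet {a | f a < ε} := measurableSet_lt hf measurable_const
  -- The probability that k consecutive copies from index n on all stay below ε is the k-th power of
  -- a number less than 1. Hence values of at least ε occur beyond every index.
  have key : ∀ n : ℕ, ∀ᵐ v ∂Measure.infinitePi (fun _ : ℕ => ρ), ∃ i ≥ n, ε ≤ f (v i) := by
    intro n
    rw [ae_iff]
    have hle : ∀ k : ℕ, Measure.infinitePi (fun _ : ℕ => ρ) {v | ¬ ∃ i ≥ n, ε ≤ f (v i)} ≤
        (ρ {a | f a < ε}) ^ k := by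
      intro k
      calc _ ≤ Measure.infinitePi (fun _ : ℕ => ρ)
            (Set.pi (Finset.Ico n (n + k)) fun _ => {a | f a < ε}) := by
            refine measure_mono fun v hv i hi => ?_
            simp only [Set.mem_ofPred_eq, not_exists, not_and, not_le] at hv ⊢
            exact hv i (Finset.mem_Ico.1 (Finset.mem_coe.1 hi)).1
        _ = _ := by
            rw [Measure.infinitePi_pi _ fun _ _ => hS]
            simp
    exact le_antisymm (ge_of_tendsto' (ENNReal.tendsto_pow_atTop_nhds_zero_of_lt_one hlt) hle)
      zero_le
  filter_upwards [ae_all_iff.2 key] with v hv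
  by_contra hne
  have h0 := ENNReal.tendsto_atTop_zero_of_tsum_ne_top hne
  obtain ⟨N, hN⟩ := Filter.eventually_atTop.1 (h0.eventually (gt_mem_nhds hε))
  obtain ⟨i, hi, hle⟩ := hv N
  exact absurd (hN i hi) (not_lt.2 hle)

/-- The later tours have i.i.d. lifetimes, almost surely positive because a regular tour needs
positive time to reach its first event. Their sum is therefore infinite, and adding the first
lifetime preserves this. -/
lemma ae_isRegularSample (hrate_meas : Measurable rate) (hκ_meas : Measurable κ)
    (hrate : ∀ x, 0 < rate x) (hκ : ∀ x, 0 ≤ κ x) (hne : Nonexplosive P rate)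
    (ν : Measure E) [IsProbabilityMeasure ν] (x : E) :
    ∀ᵐ ω ∂restoreKernel P ν x, IsRegularSample rate κ ω := by
  have h1 : ∀ᵐ l ∂(lifeKernel P ∘ₘ ν), IsRegularLife rate l :=
    Measure.ae_comp_of_ae_ae (measurableSet_isRegularLife hrate_meas)
      (Filter.Eventually.of_forall fun y => ae_isRegularLife hne y)
  have h2 : ∀ᵐ v ∂Measure.infinitePi (fun _ : ℕ => lifeKernel P ∘ₘ ν),
      ∀ i, IsRegularLife rate (v i) := by
    rw [ae_all_iff]
    intro i
    exact (measurePreserving_eval_infinitePi (fun _ : ℕ => lifeKernel P ∘ₘ ν)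
      i).quasiMeasurePreserving.ae h1
  have h3 := ae_tsum_infinitePi_eq_top (lifeKernel P ∘ₘ ν)
    (measurable_lifetime hrate_meas hκ_meas) (h1.mono fun l hl => hl.lifetime_pos hrate hκ)
  rw [restoreKernel, Kernel.prod_apply, Kernel.const_apply]
  filter_upwards [Measure.quasiMeasurePreserving_fst.ae (ae_isRegularLife hne x),
    Measure.quasiMeasurePreserving_snd.ae h2, Measure.quasiMeasurePreserving_snd.ae h3]
    with ω h1 h2 h3
  refine ⟨fun i => ?_, ?_⟩
  · cases i with
    | zero => exact h1
    | succ i => exact h2 i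
  · rw [← Filter.tendsto_add_atTop_iff_nat 1]
    have h4 := ENNReal.tendsto_nat_tsum fun i => lifetime rate κ (ω.2 i)
    rw [h3] at h4
    refine tendsto_nhds_top_mono h4 (Filter.Eventually.of_forall fun n => ?_)
    change ∑ i ∈ Finset.range n, lifetime rate κ (ω.2 i) ≤ regenTime rate κ ω (n + 1)
    rw [regenTime_succ]
    refine le_of_eq_of_le ?_ le_add_self
    simp only [regenTime, tour_regenShift]
    rfl

end AlmostSure

/-! ### Competing exponential clocks -/

section CompetingClocks

lemma lintegral_comp_mul_left_eq {a : ℝ} (ha : 0 < a) (S : Set ℝ) (f : ℝ → ENNReal) :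
    ∫⁻ r in S, f r = ENNReal.ofReal a * ∫⁻ r in (a * ·) ⁻¹' S, f (a * r) := by
  have he : MeasurableEmbedding (a * · : ℝ → ℝ) := measurableEmbedding_mulLeft₀ ha.ne'
  conv_lhs => rw [← Real.smul_map_volume_mul_left ha.ne', abs_of_pos ha]
  rw [Measure.restrict_smul, lintegral_smul_measure, he.restrict_map, he.lintegral_map,
    smul_eq_mul]

lemma lintegral_expMeasure_div {a : ℝ} (ha : 0 < a) {f : ℝ → ENNReal} (hf : Measurable f) :
    ∫⁻ e, f (e / a) ∂expMeasure 1 =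
      ∫⁻ r in Set.Ioi 0, ENNReal.ofReal (a * Real.exp (-(a * r))) * f r := by
  rw [lintegral_expMeasure_one (by fun_prop), lintegral_comp_mul_left_eq ha]
  have h : (a * ·) ⁻¹' Set.Ioi (0 : ℝ) = Set.Ioi 0 := by
    ext r
    simp [ha]
  rw [h, ← lintegral_const_mul' _ _ ENNReal.ofReal_ne_top]
  refine lintegral_congr fun r => ?_
  rw [mul_div_cancel_left₀ _ ha.ne', ENNReal.ofReal_mul ha.le, mul_assoc]

lemma lintegral_exp_tail {a : ℝ} (ha : 0 < a) (v : ℝ) :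
    ∫⁻ r in Set.Ioi v, ENNReal.ofReal (a * Real.exp (-(a * r))) =
      ENNReal.ofReal (Real.exp (-(a * v))) := by
  have h1 := lintegral_expMeasure_div ha (f := fun _ => 1) measurable_const
  simp only [lintegral_const, measure_univ, mul_one] at h1
  rw [lintegral_Ioi_shift]
  calc _ = ∫⁻ r in Set.Ioi 0, ENNReal.ofReal (Real.exp (-(a * v))) *
        ENNReal.ofReal (a * Real.exp (-(a * r))) := by
        refine lintegral_congr fun r => ?_
        rw [← ENNReal.ofReal_mul (by positivity), mul_add, neg_add, Real.exp_add]
        ring_nf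
    _ = _ := by rw [lintegral_const_mul' _ _ ENNReal.ofReal_ne_top, ← h1, mul_one]

/-- Split at ξ = k r. Above it, memorylessness makes ξ - k r exponential again; below it, substitute
ξ = k v. For k = 0 the substitution is unavailable, but the interval is empty. -/
lemma lintegral_second_clock {k r : ℝ} (hk : 0 ≤ k) (hr : 0 ≤ r) {H : ℝ → ENNReal}
    (hH : Measurable H) {K : ℝ → ENNReal} (hK : Measurable K) :
    ∫⁻ ξ, (if k * r < ξ then H (ξ - k * r) else K (ξ / k)) ∂expMeasure 1 =
      ENNReal.ofReal (Real.exp (-(k * r))) * (∫⁻ ξ, H ξ ∂expMeasure 1) +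
        ENNReal.ofReal k * ∫⁻ v in Set.Ioc 0 r, ENNReal.ofReal (Real.exp (-(k * v))) * K v := by
  have hkr : 0 ≤ k * r := mul_nonneg hk hr
  have hm : Measurable fun ξ => if k * r < ξ then H (ξ - k * r) else K (ξ / k) :=
    Measurable.ite (measurableSet_lt measurable_const measurable_id) (by fun_prop) (by fun_prop)
  rw [lintegral_expMeasure_one hm, ← Set.Ioc_union_Ioi_eq_Ioi hkr,
    lintegral_union measurableSet_Ioi (Set.Ioc_disjoint_Ioi le_rfl), add_comm]
  congr 1
  · rw [lintegral_Ioi_shift, lintegral_expMeasure_one hH,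
      ← lintegral_const_mul' _ _ ENNReal.ofReal_ne_top]
    refine setLIntegral_congr_fun measurableSet_Ioi fun ξ hξ => ?_
    have hξ' : k * r < k * r + ξ := by simpa using hξ
    rw [if_pos hξ', add_sub_cancel_left, ← mul_assoc, ← ENNReal.ofReal_mul (by positivity),
      ← Real.exp_add, neg_add]
  · rcases hk.eq_or_lt with rfl | hk
    · simp
    · rw [lintegral_comp_mul_left_eq hk]
      have h : (k * ·) ⁻¹' Set.Ioc (0 : ℝ) (k * r) = Set.Ioc 0 r := by
        ext v
        simp [hk, mul_div_cancel_left₀ _ hk.ne']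
      rw [h]
      congr 1
      refine setLIntegral_congr_fun measurableSet_Ioc fun v hv => ?_
      have hv' : ¬ k * r < k * v := by
        rw [not_lt]
        exact mul_le_mul_of_nonneg_left hv.2 hk.le
      rw [if_neg hv', mul_div_cancel_left₀ _ hk.ne']

/-- Competing exponential clocks with the rates `a` and `k`: if the first one rings first, the
remaining time of the second one is again exponential. -/
lemma lintegral_competing_clocks {a k : ℝ} (ha : 0 < a) (hk : 0 ≤ k) {H : ℝ → ℝ → ENNReal}
    (hH : Measurable fun p : ℝ × ℝ => H p.1 p.2) {K : ℝ → ENNReal} (hK : Measurable K) :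
    ∫⁻ e, ∫⁻ ξ, (if k * (e / a) < ξ then H (e / a) (ξ - k * (e / a)) else K (ξ / k))
        ∂expMeasure 1 ∂expMeasure 1 =
      ∫⁻ r in Set.Ioi 0, ENNReal.ofReal (Real.exp (-((a + k) * r))) *
        (ENNReal.ofReal a * (∫⁻ ξ, H r ξ ∂expMeasure 1) + ENNReal.ofReal k * K r) := by
  have hHr : ∀ r, Measurable (H r) := fun r => hH.comp measurable_prodMk_left
  have hHm : Measurable fun r => ∫⁻ ξ, H r ξ ∂expMeasure 1 := hH.lintegral_prod_right'
  have hm : Measurable fun r => ∫⁻ ξ, (if k * r < ξ then H r (ξ - k * r) else K (ξ / k))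
      ∂expMeasure 1 := by
    have : Measurable fun p : ℝ × ℝ =>
        if k * p.1 < p.2 then H p.1 (p.2 - k * p.1) else K (p.2 / k) := by
      refine Measurable.ite (measurableSet_lt (by fun_prop) measurable_snd) ?_ (by fun_prop)
      exact hH.comp (f := fun p : ℝ × ℝ => (p.1, p.2 - k * p.1)) (by fun_prop)
    exact this.lintegral_prod_right'
  rw [lintegral_expMeasure_div ha hm]
  have h1 : ∫⁻ r in Set.Ioi 0, ENNReal.ofReal (a * Real.exp (-(a * r))) *
        (∫⁻ ξ, (if k * r < ξ then H r (ξ - k * r) else K (ξ / k)) ∂expMeasure 1) =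
      ∫⁻ r in Set.Ioi 0, (ENNReal.ofReal (Real.exp (-((a + k) * r))) *
        (ENNReal.ofReal a * (∫⁻ ξ, H r ξ ∂expMeasure 1)) +
        ENNReal.ofReal k * ∫⁻ v in Set.Ioi 0,
          (Set.Ici v).indicator (fun r => ENNReal.ofReal (a * Real.exp (-(a * r))) *
            (ENNReal.ofReal (Real.exp (-(k * v))) * K v)) r) := by
    refine setLIntegral_congr_fun measurableSet_Ioi fun r hr => ?_
    rw [lintegral_second_clock hk (le_of_lt hr) (hHr r) hK, mul_add]
    congr 1
    · rw [← mul_assoc, ← mul_assoc, ← ENNReal.ofReal_mul (by positivity),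
        ← ENNReal.ofReal_mul (by positivity), add_mul, neg_add, Real.exp_add]
      ring_nf
    · rw [mul_left_comm, ← lintegral_const_mul' _ _ ENNReal.ofReal_ne_top]
      congr 1
      rw [← lintegral_indicator measurableSet_Ioc, ← lintegral_indicator measurableSet_Ioi]
      refine lintegral_congr fun v => ?_
      simp only [Set.indicator_apply, Set.mem_Ioc, Set.mem_Ioi, Set.mem_Ici]
      split_ifs <;> first | rfl | (exfalso; grind)
  have hm2 : Measurable fun p : ℝ × ℝ =>
      (Set.Ici p.2).indicator (fun r => ENNReal.ofReal (a * Real.exp (-(a * r))) *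
            (ENNReal.ofReal (Real.exp (-(k * p.2))) * K p.2)) p.1 := by
    have hS : MeasurableSet {p : ℝ × ℝ | p.2 ≤ p.1} :=
      measurableSet_le measurable_snd measurable_fst
    have hf : Measurable fun p : ℝ × ℝ => ENNReal.ofReal (a * Real.exp (-(a * p.1))) *
            (ENNReal.ofReal (Real.exp (-(k * p.2))) * K p.2) := by fun_prop
    exact hf.indicator hS
  -- When the second clock rings at v, the first one only has to ring later: integrating it out over
  -- r ≥ v leaves the tail exp(-a v).
  have h2 : ∫⁻ r in Set.Ioi 0, ∫⁻ v in Set.Ioi 0,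
          (Set.Ici v).indicator (fun r => ENNReal.ofReal (a * Real.exp (-(a * r))) *
            (ENNReal.ofReal (Real.exp (-(k * v))) * K v)) r =
      ∫⁻ v in Set.Ioi 0, ENNReal.ofReal (Real.exp (-((a + k) * v))) * K v := by
    rw [lintegral_lintegral_swap hm2.aemeasurable]
    refine setLIntegral_congr_fun measurableSet_Ioi fun v hv => ?_
    rw [lintegral_indicator measurableSet_Ici, Measure.restrict_restrict measurableSet_Ici]
    have : Set.Ici v ∩ Set.Ioi 0 = Set.Ici v := by
      rw [Set.inter_eq_left]
      exact fun r hr => Set.mem_Ioi.2 (lt_of_lt_of_le (Set.mem_Ioi.1 hv) (Set.mem_Ici.1 hr))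
    rw [this, setLIntegral_congr Ioi_ae_eq_Ici.symm, lintegral_mul_const _ (by fun_prop),
      lintegral_exp_tail ha, ← mul_assoc, ← ENNReal.ofReal_mul (by positivity), ← Real.exp_add,
      add_mul, neg_add]
  rw [h1, lintegral_add_left (by fun_prop), lintegral_const_mul' _ _ ENNReal.ofReal_ne_top, h2,
    ← lintegral_const_mul' _ _ ENNReal.ofReal_ne_top, ← lintegral_add_left (by fun_prop)]
  refine lintegral_congr fun r => ?_
  ring

end CompetingClocks

/-! ### The law of the first event of the Restore process -/

section Law

variable {E : Type*} [MeasurableSpace E] {rate κ : E → ℝ} (P : Kernel E E) [IsMarkovKernel P]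
  (ν : Measure E)

/-- The intensities of the events of the Restore process: from `x`, it jumps to `dy` with
intensity `rate x P x dy`, and regenerates from `dy` with intensity `κ x ν dy`. -/
noncomputable def eventKernel (hrate : Measurable rate) (hκ : Measurable κ) : Kernel E E where
  toFun x := ENNReal.ofReal (rate x) • P x + ENNReal.ofReal (κ x) • ν
  measurable' := by
    refine Measure.measurable_of_measurable_coe _ fun s hs => ?_
    simp only [Measure.coe_add, Measure.coe_smul, Pi.add_apply, Pi.smul_apply, smul_eq_mul]
    exact (hrate.ennreal_ofReal.mul (Kernel.measurable_coe P hs)).add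
      (hκ.ennreal_ofReal.mul_const _)

lemma lintegral_eventKernel (hrate : Measurable rate) (hκ : Measurable κ) (x : E)
    (g : E → ENNReal) :
    ∫⁻ y, g y ∂eventKernel P ν hrate hκ x =
      ENNReal.ofReal (rate x) * (∫⁻ y, g y ∂P x) + ENNReal.ofReal (κ x) * ∫⁻ y, g y ∂ν := by
  change ∫⁻ y, g y ∂(ENNReal.ofReal (rate x) • P x + ENNReal.ofReal (κ x) • ν) = _
  rw [lintegral_add_measure, lintegral_smul_measure, lintegral_smul_measure]
  rfl

/-- The rates need not be bounded, so finiteness is not available; s-finiteness suffices for the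
measurability of integrals against this kernel. -/
instance isSFiniteKernel_eventKernel [SFinite ν] (hrate : Measurable rate) (hκ : Measurable κ) :
    IsSFiniteKernel (eventKernel P ν hrate hκ) := by
  have h1 : IsSFiniteKernel (Kernel.withDensity P fun x _ => ENNReal.ofReal (rate x)) :=
    Kernel.IsSFiniteKernel.withDensity _ fun _ _ => ENNReal.ofReal_ne_top
  have h2 : IsSFiniteKernel
      (Kernel.withDensity (Kernel.const E ν) fun x _ => ENNReal.ofReal (κ x)) :=
    Kernel.IsSFiniteKernel.withDensity _ fun _ _ => ENNReal.ofReal_ne_top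
  have h : eventKernel P ν hrate hκ = Kernel.withDensity P (fun x _ => ENNReal.ofReal (rate x)) +
      Kernel.withDensity (Kernel.const E ν) (fun x _ => ENNReal.ofReal (κ x)) := by
    ext x : 1
    refine Measure.ext_of_lintegral _ fun g hg => ?_
    rw [lintegral_eventKernel, add_apply, lintegral_add_measure,
      Kernel.lintegral_withDensity _ (by unfold Function.uncurry; fun_prop) _ hg,
      Kernel.lintegral_withDensity _ (by unfold Function.uncurry; fun_prop) _ hg,
      lintegral_const_mul _ hg, lintegral_const_mul _ hg]
    rfl
  rw [h]
  infer_instance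

/-- The first step of the chain and the first clock are split off; the remaining chain and clocks
form a fresh jump sample started at the new state. -/
lemma lintegral_jumpKernel (x : E) {F : JumpSample E → ENNReal} (hF : Measurable F) :
    ∫⁻ ω, F ω ∂jumpKernel P x =
      ∫⁻ e, ∫⁻ y, ∫⁻ ω, F (consSeq x ω.1, consSeq e ω.2) ∂jumpKernel P y ∂P x ∂expMeasure 1 := by
  have h : ∀ (y : E) (F : JumpSample E → ENNReal), Measurable F → ∫⁻ ω, F ω ∂jumpKernel P y =
      ∫⁻ z, ∫⁻ e, F (z, e) ∂Measure.infinitePi (fun _ : ℕ => expMeasure 1) ∂chainKernel P y := by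
    intro y F hF
    rw [jumpKernel, Kernel.prod_apply, Kernel.const_apply, lintegral_prod _ hF.aemeasurable]
  have hF' : Measurable fun z =>
      ∫⁻ e, F (z, e) ∂Measure.infinitePi (fun _ : ℕ => expMeasure 1) := hF.lintegral_prod_right'
  have hm : Measurable fun p : ℝ × JumpSample E => F (consSeq x p.2.1, consSeq p.1 p.2.2) := by
    fun_prop
  have hm1 : Measurable fun p : ℝ × E =>
      ∫⁻ ω, F (consSeq x ω.1, consSeq p.1 ω.2) ∂jumpKernel P p.2 := by
    have : Measurable fun p : (ℝ × E) × JumpSample E =>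
        F (consSeq x p.2.1, consSeq p.1.1 p.2.2) := by fun_prop
    exact this.lintegral_kernel_prod_right' (κ := (jumpKernel P).comap Prod.snd measurable_snd)
  have hm2 : Measurable fun p : ℝ × (ℕ → E) =>
      ∫⁻ e, F (consSeq x p.2, consSeq p.1 e) ∂Measure.infinitePi (fun _ : ℕ => expMeasure 1) := by
    have : Measurable fun p : (ℝ × (ℕ → E)) × (ℕ → ℝ) =>
        F (consSeq x p.1.2, consSeq p.1.1 p.2) := by fun_prop
    exact this.lintegral_prod_right'
  rw [h x F hF, lintegral_chainKernel P x hF', lintegral_lintegral_swap hm1.aemeasurable]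
  refine lintegral_congr fun y => ?_
  have h1 : ∀ e, ∫⁻ ω, F (consSeq x ω.1, consSeq e ω.2) ∂jumpKernel P y =
      ∫⁻ z, ∫⁻ e', F (consSeq x z, consSeq e e')
        ∂Measure.infinitePi (fun _ : ℕ => expMeasure 1) ∂chainKernel P y :=
    fun e => h y _ (hm.comp measurable_prodMk_left)
  simp_rw [h1]
  refine Eq.trans ?_ (lintegral_lintegral_swap hm2.aemeasurable).symm
  refine lintegral_congr fun z => ?_
  exact lintegral_infinitePi_consSeq (expMeasure 1) (hF.comp measurable_prodMk_left)

instance isMarkovKernel_restoreKernel [IsProbabilityMeasure ν] :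
    IsMarkovKernel (restoreKernel P ν) := by
  unfold restoreKernel; infer_instance

lemma lintegral_restoreKernel_eq_lifeKernel [IsProbabilityMeasure ν] (x : E)
    {F : Sample E → ENNReal} (hF : Measurable F) :
    ∫⁻ ω, F ω ∂restoreKernel P ν x =
      ∫⁻ l, ∫⁻ v, F (l, v) ∂Measure.infinitePi (fun _ : ℕ => lifeKernel P ∘ₘ ν)
        ∂lifeKernel P x := by
  rw [restoreKernel, Kernel.prod_apply, Kernel.const_apply, lintegral_prod _ hF.aemeasurable]

lemma lintegral_restoreKernel_eq_jumpKernel [IsProbabilityMeasure ν] (x : E)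
    {F : Sample E → ENNReal} (hF : Measurable F) :
    ∫⁻ ω, F ω ∂restoreKernel P ν x =
      ∫⁻ ω, ∫⁻ ξ, ∫⁻ v, F ((ω, ξ), v) ∂Measure.infinitePi (fun _ : ℕ => lifeKernel P ∘ₘ ν)
        ∂expMeasure 1 ∂jumpKernel P x := by
  have hF' : Measurable fun l : Life E =>
      ∫⁻ v, F (l, v) ∂Measure.infinitePi (fun _ : ℕ => lifeKernel P ∘ₘ ν) :=
    hF.lintegral_prod_right'
  have hl : lifeKernel P x = (jumpKernel P x).prod (expMeasure 1) := by
    rw [lifeKernel, Kernel.prod_apply, Kernel.const_apply]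
  rw [lintegral_restoreKernel_eq_lifeKernel P ν x hF, hl, lintegral_prod _ hF'.aemeasurable]

/-- Tonelli brings the lifetime clock ξ to the outside, as required to match the form produced by
`lintegral_competing_clocks`. -/
lemma lintegral_comp_restoreKernel [IsProbabilityMeasure ν] (x : E)
    {F : Sample E → ENNReal} (hF : Measurable F) :
    ∫⁻ y, ∫⁻ ω, F ω ∂restoreKernel P ν y ∂P x =
      ∫⁻ ξ, ∫⁻ y, ∫⁻ ω, ∫⁻ v, F ((ω, ξ), v)
        ∂Measure.infinitePi (fun _ : ℕ => lifeKernel P ∘ₘ ν) ∂jumpKernel P y ∂P x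
        ∂expMeasure 1 := by
  have hm : Measurable fun p : JumpSample E × ℝ =>
      ∫⁻ v, F (p, v) ∂Measure.infinitePi (fun _ : ℕ => lifeKernel P ∘ₘ ν) :=
    hF.lintegral_prod_right'
  have hm' : Measurable fun p : ℝ × E => ∫⁻ ω, ∫⁻ v, F ((ω, p.1), v)
      ∂Measure.infinitePi (fun _ : ℕ => lifeKernel P ∘ₘ ν) ∂jumpKernel P p.2 := by
    have : Measurable fun p : (ℝ × E) × JumpSample E =>
        ∫⁻ v, F ((p.2, p.1.1), v) ∂Measure.infinitePi (fun _ : ℕ => lifeKernel P ∘ₘ ν) :=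
      hm.comp (f := fun p : (ℝ × E) × JumpSample E => (p.2, p.1.1)) (by fun_prop)
    exact this.lintegral_kernel_prod_right' (κ := (jumpKernel P).comap Prod.snd measurable_snd)
  rw [lintegral_lintegral_swap hm'.aemeasurable]
  refine lintegral_congr fun y => ?_
  rw [lintegral_restoreKernel_eq_jumpKernel P ν y hF]
  exact lintegral_lintegral_swap hm.aemeasurable

/-- After a regeneration the first of the i.i.d. later tours becomes the current one, and its
starting point has law ν. -/
lemma lintegral_regenShift [IsProbabilityMeasure ν] {F : Sample E → ENNReal}
    (hF : Measurable F) :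
    ∫⁻ v, F (v 0, fun i => v (i + 1)) ∂Measure.infinitePi (fun _ : ℕ => lifeKernel P ∘ₘ ν) =
      ∫⁻ y, ∫⁻ ω, F ω ∂restoreKernel P ν y ∂ν := by
  have hF' : Measurable fun l : Life E =>
      ∫⁻ v, F (l, v) ∂Measure.infinitePi (fun _ : ℕ => lifeKernel P ∘ₘ ν) :=
    hF.lintegral_prod_right'
  rw [lintegral_infinitePi_consSeq _ (F := fun v => F (v 0, fun i => v (i + 1))) (by fun_prop)]
  simp only [consSeq_zero, consSeq_succ]
  rw [Measure.lintegral_bind (Kernel.aemeasurable _) hF'.aemeasurable]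
  exact lintegral_congr fun y => (lintegral_restoreKernel_eq_lifeKernel P ν y hF).symm

/-- The law of the first event of the Restore process and of what follows it. -/
lemma lintegral_first_event [IsProbabilityMeasure ν] (hrate : Measurable rate)
    (hκ : Measurable κ) (hrate_pos : ∀ x, 0 < rate x) (hκ_nonneg : ∀ x, 0 ≤ κ x) (x : E)
    {Φ : E × ℝ × Sample E → ENNReal} (hΦ : Measurable Φ) :
    ∫⁻ ω, Φ (ω.1.1.1 0, firstEvent rate κ ω, eventShift rate κ ω) ∂restoreKernel P ν x =
      ∫⁻ r in Set.Ioi 0, ENNReal.ofReal (Real.exp (-((rate x + κ x) * r))) *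
        ∫⁻ y, ∫⁻ ω, Φ (x, r, ω) ∂restoreKernel P ν y ∂eventKernel P ν hrate hκ x := by
  classical
  set V := Measure.infinitePi fun _ : ℕ => lifeKernel P ∘ₘ ν with hV
  have hF : Measurable fun ω : Sample E =>
      Φ (ω.1.1.1 0, firstEvent rate κ ω, eventShift rate κ ω) := by
    have h1 := measurable_firstEvent (E := E) hrate hκ
    have h2 := measurable_eventShift (E := E) hrate hκ
    fun_prop
  have hFV : Measurable fun p : JumpSample E × ℝ =>
      ∫⁻ v, Φ (p.1.1 0, firstEvent rate κ (p, v), eventShift rate κ (p, v)) ∂V :=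
    hF.lintegral_prod_right'
  -- `H` is the continuation after a jump at time r with residual clock ξ, and `K` the continuation
  -- after a regeneration at time r.
  set H : ℝ → ℝ → ENNReal := fun r ξ =>
    ∫⁻ y, ∫⁻ ω, ∫⁻ v, Φ (x, r, (ω, ξ), v) ∂V ∂jumpKernel P y ∂P x with hH
  set K : ℝ → ENNReal := fun r => ∫⁻ v, Φ (x, r, v 0, fun i => v (i + 1)) ∂V with hK
  have hHm : Measurable fun p : ℝ × ℝ => H p.1 p.2 := by
    have h1 : Measurable fun p : (((ℝ × ℝ) × E) × JumpSample E) × (ℕ → Life E) =>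
      Φ (x, p.1.1.1.1, (p.1.2, p.1.1.1.2), p.2) := by fun_prop
    have h2 : Measurable fun p : ((ℝ × ℝ) × E) × JumpSample E =>
      ∫⁻ v, Φ (x, p.1.1.1, (p.2, p.1.1.2), v) ∂V := h1.lintegral_prod_right'
    have h3 := h2.lintegral_kernel_prod_right'
      (κ := (jumpKernel P).comap (Prod.snd : (ℝ × ℝ) × E → E) measurable_snd)
    exact h3.lintegral_prod_right'
  have hKm : Measurable K := by
    have : Measurable fun p : ℝ × (ℕ → Life E) => Φ (x, p.1, p.2 0, fun i => p.2 (i + 1)) := by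
      fun_prop
    exact this.lintegral_prod_right'
  have hswap : ∫⁻ ω, Φ (ω.1.1.1 0, firstEvent rate κ ω, eventShift rate κ ω)
        ∂restoreKernel P ν x =
      ∫⁻ e, ∫⁻ ξ, ∫⁻ y, ∫⁻ ω, ∫⁻ v,
        Φ (x, firstEvent rate κ (((consSeq x ω.1, consSeq e ω.2), ξ), v),
          eventShift rate κ (((consSeq x ω.1, consSeq e ω.2), ξ), v)) ∂V
        ∂jumpKernel P y ∂P x ∂expMeasure 1 ∂expMeasure 1 := by
    rw [lintegral_restoreKernel_eq_jumpKernel P ν x hF,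
      lintegral_jumpKernel P x hFV.lintegral_prod_right']
    refine lintegral_congr fun e => ?_
    have hm : Measurable fun p : JumpSample E × ℝ =>
        ∫⁻ v, Φ (x, firstEvent rate κ (((consSeq x p.1.1, consSeq e p.1.2), p.2), v),
          eventShift rate κ (((consSeq x p.1.1, consSeq e p.1.2), p.2), v)) ∂V :=
      hFV.comp (f := fun p : JumpSample E × ℝ => ((consSeq x p.1.1, consSeq e p.1.2), p.2))
        (by fun_prop)
    have hm' : Measurable fun p : ℝ × E => ∫⁻ ω, ∫⁻ v,
        Φ (x, firstEvent rate κ (((consSeq x ω.1, consSeq e ω.2), p.1), v),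
          eventShift rate κ (((consSeq x ω.1, consSeq e ω.2), p.1), v)) ∂V ∂jumpKernel P p.2 := by
      have h2 := hm.comp (f := fun p : (ℝ × E) × JumpSample E => (p.2, p.1.1)) (by fun_prop)
      exact h2.lintegral_kernel_prod_right'
        (κ := (jumpKernel P).comap (Prod.snd : ℝ × E → E) measurable_snd)
    rw [lintegral_lintegral_swap hm'.aemeasurable]
    refine lintegral_congr fun y => ?_
    exact lintegral_lintegral_swap hm.aemeasurable
  have hcase : ∀ e ξ, ∫⁻ y, ∫⁻ ω, ∫⁻ v,
        Φ (x, firstEvent rate κ (((consSeq x ω.1, consSeq e ω.2), ξ), v),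
          eventShift rate κ (((consSeq x ω.1, consSeq e ω.2), ξ), v)) ∂V
        ∂jumpKernel P y ∂P x =
      if κ x * (e / rate x) < ξ then H (e / rate x) (ξ - κ x * (e / rate x)) else K (ξ / κ x) := by
    intro e ξ
    simp only [firstEvent, eventShift, firstTourShift, regenShift, jumpShift, jumpTime_one,
      consSeq_zero, consSeq_succ]
    split_ifs with hc
    · rfl
    · simp [hK]
  rw [hswap]
  simp_rw [hcase]
  rw [lintegral_competing_clocks (hrate_pos x) (hκ_nonneg x) hHm hKm]
  refine lintegral_congr fun r => ?_
  have hΦr : Measurable fun ω => Φ (x, r, ω) := by fun_prop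
  rw [lintegral_eventKernel, lintegral_comp_restoreKernel P ν x hΦr,
    ← lintegral_regenShift P ν hΦr]

/-- The Restore process is decomposed at its first event. -/
lemma firstEventDecomposition_restore [IsProbabilityMeasure ν] (hrate : Measurable rate)
    (hκ : Measurable κ) (hrate_pos : ∀ x, 0 < rate x) (hκ_nonneg : ∀ x, 0 ≤ κ x)
    (hne : Nonexplosive P rate) :
    FirstEventDecomposition (restoreKernel P ν) (eventKernel P ν hrate hκ)
      (fun x => rate x + κ x) (restoreProcess rate κ) (fun ω => ω.1.1.1 0) (firstEvent rate κ)
      (eventShift rate κ) {ω | IsRegularSample rate κ ω} where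
  measurable_process := measurable_restoreProcess hrate hκ
  measurable_time := measurable_firstEvent hrate hκ
  measurable_shift := measurable_eventShift hrate hκ
  ae_mem x := ae_isRegularSample hrate hκ hrate_pos hκ_nonneg hne ν x
  shift_mem _ hω := IsRegularSample.eventShift hω hrate_pos hκ_nonneg
  time_pos _ hω := IsRegularSample.firstEvent_pos hω hrate_pos hκ_nonneg
  process_eq_initial _ hω _ _ ht := IsRegularSample.restoreProcess_of_lt hω hrate_pos hκ_nonneg ht
  process_shift _ hω _ ht := IsRegularSample.restoreProcess_add hω hrate_pos hκ_nonneg ht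
  exists_lt_eventTime _ hω M := IsRegularSample.exists_lt_eventTime hω hrate_pos hκ_nonneg M
  law x _ hΦ := lintegral_first_event P ν hrate hκ hrate_pos hκ_nonneg x hΦ

end Law

/-! ### The balance equation for π -/

section Invariance

variable {E : Type*} [MeasurableSpace E] {m : Measure E} [SigmaFinite m]
  {P : Kernel E E} [IsMarkovKernel P] {p : E → E → ℝ} {rate π μ : E → ℝ} {C : ℝ}

lemma measurable_regenRate (hp : Measurable (Function.uncurry p)) (hrate : Measurable rate)
    (hπ : Measurable π) (hμ : Measurable μ) : Measurable (regenRate m p rate π μ C) := by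
  have h1 : Measurable fun q : E × E => π q.2 * rate q.2 * p q.2 q.1 :=
    Measurable.mul (by fun_prop) (hp.comp measurable_swap)
  have h2 : Measurable fun x => ∫ y, π y * rate y * p y x ∂m :=
    h1.stronglyMeasurable.integral_prod_right'.measurable
  unfold regenRate
  fun_prop

/-- The flux into `g` of the jumps of the interarrival process in equilibrium. -/
lemma lintegral_jump_flux (hp_meas : Measurable (Function.uncurry p))
    (hp_nonneg : ∀ x y, 0 ≤ p x y)
    (hP : ∀ x, P x = m.withDensity fun y => ENNReal.ofReal (p x y))
    (hrate_meas : Measurable rate) (hrate_pos : ∀ x, 0 < rate x)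
    (hπ_meas : Measurable π) (hπ_pos : ∀ x, 0 < π x)
    (hκ_def : ∀ x, Integrable (fun y => π y * rate y * p y x) m)
    {g : E → ENNReal} (hg : Measurable g) :
    ∫⁻ x, ENNReal.ofReal (π x * rate x) * (∫⁻ y, g y ∂P x) ∂m =
      ∫⁻ x, ENNReal.ofReal (∫ y, π y * rate y * p y x ∂m) * g x ∂m := by
  have hpx : ∀ x, Measurable (p x) := fun x => hp_meas.comp measurable_prodMk_left
  have hm : Measurable fun q : E × E =>
      ENNReal.ofReal (π q.1 * rate q.1 * p q.1 q.2) * g q.2 := by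
    have : Measurable fun q : E × E => p q.1 q.2 := hp_meas
    fun_prop
  have h1 : ∀ x, ENNReal.ofReal (π x * rate x) * (∫⁻ y, g y ∂P x) =
      ∫⁻ y, ENNReal.ofReal (π x * rate x * p x y) * g y ∂m := by
    intro x
    have h0 : 0 ≤ π x * rate x := (mul_pos (hπ_pos x) (hrate_pos x)).le
    rw [hP, lintegral_withDensity_eq_lintegral_mul _ (hpx x).ennreal_ofReal hg,
      ← lintegral_const_mul' _ _ ENNReal.ofReal_ne_top]
    refine lintegral_congr fun y => ?_
    rw [ENNReal.ofReal_mul h0, Pi.mul_apply, mul_assoc]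
  simp_rw [h1]
  rw [lintegral_lintegral_swap hm.aemeasurable]
  refine lintegral_congr fun y => ?_
  rw [lintegral_mul_const, ofReal_integral_eq_lintegral_ofReal (hκ_def y)]
  · exact Filter.Eventually.of_forall fun x =>
      mul_nonneg (mul_pos (hπ_pos x) (hrate_pos x)).le (hp_nonneg x y)
  · have : Measurable fun q : E × E => p q.2 q.1 := hp_meas.comp measurable_swap
    have := this.comp (measurable_prodMk_left (x := y))
    simp only [Function.comp_def] at this
    fun_prop

lemma lintegral_ofReal_eq_one {f : E → ℝ} {ν : Measure E} [IsProbabilityMeasure ν]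
    (hν : ν = m.withDensity fun x => ENNReal.ofReal (f x)) :
    ∫⁻ x, ENNReal.ofReal (f x) ∂m = 1 := by
  rw [← setLIntegral_univ, ← withDensity_apply _ .univ, ← hν, measure_univ]

lemma integrable_density {f : E → ℝ} (hf : Measurable f) (hf0 : ∀ x, 0 ≤ f x)
    {ν : Measure E} [IsProbabilityMeasure ν]
    (hν : ν = m.withDensity fun x => ENNReal.ofReal (f x)) : Integrable f m := by
  refine ⟨hf.aestronglyMeasurable, ?_⟩
  rw [hasFiniteIntegral_iff_ofReal (Filter.Eventually.of_forall hf0), lintegral_ofReal_eq_one hν]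
  exact ENNReal.one_lt_top

lemma integral_density {f : E → ℝ} (hf : Measurable f) (hf0 : ∀ x, 0 ≤ f x)
    {ν : Measure E} [IsProbabilityMeasure ν]
    (hν : ν = m.withDensity fun x => ENNReal.ofReal (f x)) : ∫ x, f x ∂m = 1 := by
  rw [integral_eq_lintegral_of_nonneg_ae (Filter.Eventually.of_forall hf0)
    hf.aestronglyMeasurable, lintegral_ofReal_eq_one hν, ENNReal.toReal_one]

/-- The pointwise balance: the total rate out of x in equilibrium equals the density of jumps into x
plus C times the regeneration density. -/
lemma regenRate_mul_eq {x : E} (hπ : 0 < π x) :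
    (rate x + regenRate m p rate π μ C x) * π x =
      (∫ y, π y * rate y * p y x ∂m) + C * μ x := by
  unfold regenRate
  field_simp
  ring

lemma integrable_add_mul {κ : E → ℝ} (hκ : Measurable κ) (hrate : Measurable rate)
    (hπ_meas : Measurable π) (hπ_pos : ∀ x, 0 < π x) (hrate_pos : ∀ x, 0 < rate x)
    (hκ_nonneg : ∀ x, 0 ≤ κ x) (hπ : Integrable π m)
    (hsq : Integrable (fun x => (rate x + κ x) ^ 2 * π x) m) :
    Integrable (fun x => (rate x + κ x) * π x) m := by
  refine (hπ.add hsq).mono' (by fun_prop) (Filter.Eventually.of_forall fun x => ?_)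
  have h1 := hπ_pos x
  have h2 : 0 ≤ rate x + κ x := add_nonneg (hrate_pos x).le (hκ_nonneg x)
  rw [Real.norm_eq_abs, abs_of_nonneg (mul_nonneg h2 h1.le), Pi.add_apply]
  -- With q = `rate x` + κ(x), expanding (q - 1)² ≥ 0 gives 2q ≤ 1 + q², hence q ≤ 1 + q² as q ≥ 0.
  nlinarith [mul_nonneg (sq_nonneg (rate x + κ x - 1)) h1.le, mul_nonneg h2 h1.le]

/-- The total rate of regeneration in equilibrium is the constant `C`. -/
lemma lintegral_regenRate (hp_meas : Measurable (Function.uncurry p))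
    (hp_nonneg : ∀ x y, 0 ≤ p x y)
    (hP : ∀ x, P x = m.withDensity fun y => ENNReal.ofReal (p x y))
    (hrate_meas : Measurable rate) (hrate_pos : ∀ x, 0 < rate x)
    (hπ_meas : Measurable π) (hπ_pos : ∀ x, 0 < π x)
    (hμ_meas : Measurable μ) (hμ_nonneg : ∀ x, 0 ≤ μ x)
    {νμ : Measure E} [IsProbabilityMeasure νμ]
    (hνμ : νμ = m.withDensity fun x => ENNReal.ofReal (μ x))
    (hrateπ : Integrable (fun x => rate x * π x) m)
    (hκ_def : ∀ x, Integrable (fun y => π y * rate y * p y x) m)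
    (hκ_nonneg : ∀ x, 0 ≤ regenRate m p rate π μ C x) :
    0 ≤ C ∧ ∫⁻ x, ENNReal.ofReal (π x * regenRate m p rate π μ C x) ∂m = ENNReal.ofReal C := by
  have hI0 : ∀ x, 0 ≤ ∫ y, π y * rate y * p y x ∂m := fun x => integral_nonneg fun y =>
    mul_nonneg (mul_pos (hπ_pos y) (hrate_pos y)).le (hp_nonneg y x)
  have hIm : Measurable fun x => ∫ y, π y * rate y * p y x ∂m := by
    have h1 : Measurable fun q : E × E => π q.2 * rate q.2 * p q.2 q.1 :=
      Measurable.mul (by fun_prop) (hp_meas.comp measurable_swap)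
    exact h1.stronglyMeasurable.integral_prod_right'.measurable
  have hflux := lintegral_jump_flux hp_meas hp_nonneg hP hrate_meas hrate_pos hπ_meas hπ_pos
    hκ_def (g := fun _ => 1) measurable_const
  simp only [lintegral_const, measure_univ, mul_one] at hflux
  have hrateπ' : Integrable (fun x => π x * rate x) m := by
    simpa only [mul_comm] using hrateπ
  have hrp0 : ∀ x, 0 ≤ π x * rate x := fun x => (mul_pos (hπ_pos x) (hrate_pos x)).le
  have hI : Integrable (fun x => ∫ y, π y * rate y * p y x ∂m) m := by
    refine ⟨hIm.aestronglyMeasurable, ?_⟩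
    rw [hasFiniteIntegral_iff_ofReal (Filter.Eventually.of_forall hI0), ← hflux]
    exact (hasFiniteIntegral_iff_ofReal (Filter.Eventually.of_forall hrp0)).1 hrateπ'.2
  -- Jumps conserve mass: taking g = 1 in the flux identity shows that inflow and outflow of jumps
  -- have the same total, so only C ∫ μ dm = C remains in the integral of κ π.
  have hIint : ∫ x, (∫ y, π y * rate y * p y x ∂m) ∂m = ∫ x, π x * rate x ∂m := by
    rw [integral_eq_lintegral_of_nonneg_ae (Filter.Eventually.of_forall hI0)
      hIm.aestronglyMeasurable, ← hflux,
      integral_eq_lintegral_of_nonneg_ae (Filter.Eventually.of_forall hrp0) hrateπ'.1]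
  have hμi := integrable_density hμ_meas hμ_nonneg hνμ
  have hκπ : (fun x => π x * regenRate m p rate π μ C x) =
      fun x => ((∫ y, π y * rate y * p y x ∂m) + C * μ x) - π x * rate x := by
    ext x
    rw [← regenRate_mul_eq (hπ_pos x)]
    ring
  have hκπi : Integrable (fun x => π x * regenRate m p rate π μ C x) m := by
    rw [hκπ]
    exact (hI.add (hμi.const_mul C)).sub hrateπ'
  have hκπ0 : ∀ x, 0 ≤ π x * regenRate m p rate π μ C x := fun x =>
    mul_nonneg (hπ_pos x).le (hκ_nonneg x)
  have hC : ∫ x, π x * regenRate m p rate π μ C x ∂m = C := by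
    have hsum : Integrable (fun x => (∫ y, π y * rate y * p y x ∂m) + C * μ x) m :=
      hI.add (hμi.const_mul C)
    rw [hκπ, integral_sub hsum hrateπ', integral_add hI (hμi.const_mul C),
      hIint, integral_const_mul, integral_density hμ_meas hμ_nonneg hνμ]
    ring
  rw [← ofReal_integral_eq_lintegral_ofReal hκπi (Filter.Eventually.of_forall hκπ0), hC]
  -- C is an arbitrary real number in the hypotheses; its sign is forced because it is the integral
  -- of the nonnegative function κ π.
  exact ⟨hC ▸ integral_nonneg hκπ0, rfl⟩

/-- In equilibrium, the flux into `g` of all events equals the flux out of `g`. -/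
lemma lintegral_eventKernel_eq (hp_meas : Measurable (Function.uncurry p))
    (hp_nonneg : ∀ x y, 0 ≤ p x y)
    (hP : ∀ x, P x = m.withDensity fun y => ENNReal.ofReal (p x y))
    (hrate_meas : Measurable rate) (hrate_pos : ∀ x, 0 < rate x)
    (hπ_meas : Measurable π) (hπ_pos : ∀ x, 0 < π x)
    (hμ_meas : Measurable μ) (hμ_nonneg : ∀ x, 0 ≤ μ x)
    {νπ νμ : Measure E} [IsProbabilityMeasure νμ]
    (hνπ : νπ = m.withDensity fun x => ENNReal.ofReal (π x))
    (hνμ : νμ = m.withDensity fun x => ENNReal.ofReal (μ x))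
    (hrateπ : Integrable (fun x => rate x * π x) m)
    (hκ_def : ∀ x, Integrable (fun y => π y * rate y * p y x) m)
    (hκ_meas : Measurable (regenRate m p rate π μ C))
    (hκ_nonneg : ∀ x, 0 ≤ regenRate m p rate π μ C x)
    {g : E → ENNReal} (hg : Measurable g) :
    ∫⁻ x, ∫⁻ y, g y ∂eventKernel P νμ hrate_meas hκ_meas x ∂νπ =
      ∫⁻ x, ENNReal.ofReal (rate x + regenRate m p rate π μ C x) * g x ∂νπ := by
  obtain ⟨hC0, hC⟩ := lintegral_regenRate hp_meas hp_nonneg hP hrate_meas hrate_pos hπ_meas hπ_pos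
    hμ_meas hμ_nonneg hνμ hrateπ hκ_def hκ_nonneg
  have hI0 : ∀ x, 0 ≤ ∫ y, π y * rate y * p y x ∂m := fun x => integral_nonneg fun y =>
    mul_nonneg (mul_pos (hπ_pos y) (hrate_pos y)).le (hp_nonneg y x)
  have hIm : Measurable fun x => ∫ y, π y * rate y * p y x ∂m := by
    have h1 : Measurable fun q : E × E => π q.2 * rate q.2 * p q.2 q.1 :=
      Measurable.mul (by fun_prop) (hp_meas.comp measurable_swap)
    exact h1.stronglyMeasurable.integral_prod_right'.measurable
  have hPg : Measurable fun x => ∫⁻ y, g y ∂P x := hg.lintegral_kernel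
  have hJ : Measurable fun x => ∫⁻ y, g y ∂eventKernel P νμ hrate_meas hκ_meas x :=
    hg.lintegral_kernel
  rw [hνπ, lintegral_withDensity_eq_lintegral_mul _ hπ_meas.ennreal_ofReal hJ,
    lintegral_withDensity_eq_lintegral_mul _ hπ_meas.ennreal_ofReal (by fun_prop)]
  have hL : ∀ x, ENNReal.ofReal (π x) * (∫⁻ y, g y ∂eventKernel P νμ hrate_meas hκ_meas x) =
      ENNReal.ofReal (π x * rate x) * (∫⁻ y, g y ∂P x) +
        ENNReal.ofReal (π x * regenRate m p rate π μ C x) * ∫⁻ y, g y ∂νμ := by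
    intro x
    rw [lintegral_eventKernel, ENNReal.ofReal_mul (hπ_pos x).le, ENNReal.ofReal_mul (hπ_pos x).le]
    ring
  have hR : ∀ x, ENNReal.ofReal (π x) *
      (ENNReal.ofReal (rate x + regenRate m p rate π μ C x) * g x) =
      ENNReal.ofReal (∫ y, π y * rate y * p y x ∂m) * g x +
        ENNReal.ofReal C * (ENNReal.ofReal (μ x) * g x) := by
    intro x
    rw [← mul_assoc, ← ENNReal.ofReal_mul (hπ_pos x).le, mul_comm (π x),
      regenRate_mul_eq (hπ_pos x), ENNReal.ofReal_add (hI0 x) (mul_nonneg hC0 (hμ_nonneg x)),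
      ENNReal.ofReal_mul hC0]
    ring
  simp only [Pi.mul_apply, hL, hR]
  -- The jump terms agree by the flux identity. The regeneration terms agree because the factor ∫ κ
  -- π dm on the left is C.
  rw [lintegral_add_left (by fun_prop), lintegral_add_left (by fun_prop),
    lintegral_jump_flux hp_meas hp_nonneg hP hrate_meas hrate_pos hπ_meas hπ_pos hκ_def hg,
    lintegral_mul_const _ (by fun_prop), hC, lintegral_const_mul _ (by fun_prop), hνμ,
    lintegral_withDensity_eq_lintegral_mul _ hμ_meas.ennreal_ofReal hg]
  rfl

end Invariance
end Restore

/-! ### The main theorem -/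

theorem mainTheorem2 {E : Type*} [TopologicalSpace E] [MeasurableSpace E] [BorelSpace E]
    (m : Measure E) [SigmaFinite m]
    -- the transition kernel `P` with density `p` with respect to `m`, and the holding rates
    (P : Kernel E E) [IsMarkovKernel P] (p : E → E → ℝ)
    (hp_meas : Measurable (Function.uncurry p)) (hp_nonneg : ∀ x y, 0 ≤ p x y)
    (hP : ∀ x, P x = m.withDensity fun y => ENNReal.ofReal (p x y))
    (rate : E → ℝ) (hrate_meas : Measurable rate) (hrate_pos : ∀ x, 0 < rate x)
    -- the target density `π` and the regeneration density `μ`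
    (π μ : E → ℝ) (hπ_meas : Measurable π) (hπ_pos : ∀ x, 0 < π x)
    (hμ_meas : Measurable μ) (hμ_nonneg : ∀ x, 0 ≤ μ x)
    (νπ νμ : Measure E) [IsProbabilityMeasure νπ] [IsProbabilityMeasure νμ]
    (hνπ : νπ = m.withDensity fun x => ENNReal.ofReal (π x))
    (hνμ : νμ = m.withDensity fun x => ENNReal.ofReal (μ x))
    (hrateπ : Integrable (fun x => rate x * π x) m)
    -- the regeneration rate `κ` is well defined, nonnegative, locally bounded
    (C : ℝ) (κ : E → ℝ)
    (hκ_def : ∀ x, Integrable (fun y => π y * rate y * p y x) m)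
    (hκ : κ = Restore.regenRate m p rate π μ C)
    (hκ_nonneg : ∀ x, 0 ≤ κ x)
    (hκ_locBdd : ∀ x, ∃ U ∈ nhds x, ∃ B : ℝ, ∀ y ∈ U, κ y ≤ B)
    (hsq : Integrable (fun x => (rate x + κ x) ^ 2 * π x) m)
    -- the interarrival dynamics is nonexplosive
    (hne : Restore.Nonexplosive P rate) :
    -- the Restore process is a Markov process,
    Restore.IsMarkovProcess (Restore.restoreKernel P νμ) (Restore.restoreProcess rate κ) ∧
    -- it is a nonexplosive jump process,
    (∀ x, ∀ᵐ ω ∂(Restore.restoreKernel P νμ x),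
      Filter.Tendsto (Restore.regenTime rate κ ω) Filter.atTop (nhds ⊤) ∧
      Restore.IsJumpPath fun t => Restore.restoreProcess rate κ t ω) ∧
    -- and it has the invariant distribution `π(x) m(dx)`
    Restore.IsInvariantDistribution (Restore.restoreKernel P νμ)
      (Restore.restoreProcess rate κ) νπ := by
  subst hκ
  have hκ_meas : Measurable (Restore.regenRate m p rate π μ C) :=
    Restore.measurable_regenRate hp_meas hrate_meas hπ_meas hμ_meas
  have hπ_int : Integrable π m := Restore.integrable_density hπ_meas (fun x => (hπ_pos x).le) hνπ
  have hq := Restore.integrable_add_mul hκ_meas hrate_meas hπ_meas hπ_pos hrate_pos hκ_nonneg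
    hπ_int hsq
  have hq0 : ∀ x, 0 ≤ rate x + Restore.regenRate m p rate π μ C x := fun x =>
    add_nonneg (hrate_pos x).le (hκ_nonneg x)
  have hdecomp := Restore.firstEventDecomposition_restore P νμ hrate_meas hκ_meas hrate_pos hκ_nonneg hne
  refine ⟨hdecomp.isMarkovProcess, fun x => ?_, inferInstance, fun t ht => ?_⟩
  · filter_upwards [hdecomp.ae_mem x] with ω hω
    exact ⟨hω.tendsto, hdecomp.isJumpPath hω⟩
  · ext A hA
    rw [Measure.map_apply (hdecomp.measurable_process_at t) hA,
      Measure.bind_apply (hdecomp.measurable_process_at t hA) (Kernel.aemeasurable _)]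
    refine hdecomp.lintegral_process_invariant (by fun_prop) hq0 νπ ?_ (fun g hg => ?_) hA ht
    -- Finiteness of the mean total event rate under π, obtained from its finite second moment.
    · rw [hνπ, lintegral_withDensity_eq_lintegral_mul _ hπ_meas.ennreal_ofReal (by fun_prop)]
      have h1 := (hasFiniteIntegral_iff_ofReal (Filter.Eventually.of_forall fun x =>
        mul_nonneg (hq0 x) (hπ_pos x).le)).1 hq.2
      refine ne_of_eq_of_ne (lintegral_congr fun x => ?_) h1.ne
      rw [Pi.mul_apply, mul_comm, ENNReal.ofReal_mul (hq0 x)]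
    · exact Restore.lintegral_eventKernel_eq hp_meas hp_nonneg hP hrate_meas hrate_pos hπ_meas
        hπ_pos hμ_meas hμ_nonneg hνπ hνμ hrateπ hκ_def hκ_meas hκ_nonneg hg
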